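/- **Setting.** Let $J\ge 2$ and let $X^j=(X^j_1,X^j_2,\dots)$, $j\in[J]=\{1,\dots,J\}$, be data streams. For each $j$ one tests the simple null $H_0^j$: $X^j\sim P_0^j$ against the simple alternative $H_1^j$: $X^j\sim P_1^j$, where $P_0^j\ne P_1^j$ are known and mutually absolutely continuous on the first $n$ observations, for every $n$. Let $\lambda^j(n)$ be the log-likelihood ratio of $P_1^j$ to $P_0^j$ based on $X_1^j,\dots,X_n^j$, and assume $\lambda^j(n)\to-\infty$ $P_0^j$-a.s. and $\lambda^j(n)\to\infty$ $P_1^j$-a.s. For a signal set $A\subseteq[J]$ let $P_A$ (expectation $E_A$) be the law under which the streams are independent, $X^j\sim P_1^j$ for $j\in A$ and $X^j\sim P_0^j$ for $j\notin A$. Let $\mathcal P_m=\{A\subseteq[J]:|A|=m\}$. A sequential test is a pair $(T,D)$ of a stopping time $T$ of $\sigma_n=\sigma(X_i^j: i\le n, j\in[J])$ and a $\sigma_T$-measurable random set $D\subseteq[J]$ of rejected nulls. Put $R=|D|$, $V=|D\setminus A|$, $W=|A\setminus D|$ and $$\mathrm{pFDR}_A=E_A\!\left(\tfrac VR\,\middle|\,R\ge1\right),\qquad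 \mathrm{pFNR}_A=E_A\!\left(\tfrac W{J-R}\,\middle|\,J-R\ge1\right).$$ Let $\Delta_m(\alpha,\beta)$ be the class of sequential tests such that, for all $A\in\mathcal P_m$, $P_A(T<\infty)=1$, both conditional expectations are defined (the conditioning events have positive probability), $\mathrm{pFDR}_A\le\alpha$ and $\mathrm{pFNR}_A\le\beta$. With $\lambda^{(1)}(n)\ge\dots\ge\lambda^{(J)}(n)$ the ordered statistics, the gap rule with $m$ signals and threshold $c>0$ stops at $T=\inf\{n\ge1:\lambda^{(m)}(n)-\lambda^{(m+1)}(n)\ge c\}$ and then rejects the $m$ nulls with the largest statistics. For $1\le m\le J-1$ and $\alpha,\beta\in(0,1)$ let $(T_G^*,D_G^*)$ be the gap rule with $m$ signals and $c=|\log(\alpha\wedge\beta)|+\log(m(J-m))$. Let $I_0^j=E_{P_0^j}(-\lambda^j(1))$, $I_1^j=E_{P_1^j}(\lambda^j(1))$, let $v_0^j,v_1^j$ be the variances of $\lambda^j(1)$ under $P_0^j,P_1^j$, and let $\eta_0^A=\min_{j\notin A}I_0^j$, $\eta_1^A=\min_{j\in A}I_1^j$. **Corollary.** (1) For $1\le m\le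 J-1$ and $\alpha,\beta\in(0,1)$, $(T_G^*,D_G^*)\in\Delta_m(\alpha,\beta)$. Moreover the gap rule always rejects exactly $m$ nulls, so $P_A(R\ge1)=P_A(J-R\ge1)=1$ for all $A\in\mathcal P_m$. (2) Suppose in addition that each stream is i.i.d. under both its null and its alternative law, and that the information numbers $I_0^j,I_1^j$ are finite. Then, for fixed $J$, $1\le m\le J-1$ and every $A\in\mathcal P_m$, as $\alpha,\beta\to0$, $$E_A(T_G^*)\sim\frac{|\log(\alpha\wedge\beta)|}{\eta_1^A+\eta_0^A}\sim\inf_{(T,D)\in\Delta_m(\alpha,\beta)}E_A(T).$$ (3) Let the streams, their number $J$ (possibly $J\to\infty$), $m\in\{1,\dots,J-1\}$ and $A\in\mathcal P_m$ vary arbitrarily with $\alpha,\beta\in(0,1)$, as $\alpha,\beta\to0$, such that $J=o(|\log(\alpha\wedge\beta)|^{1/4})$, all $I_0^j,I_1^j$ are bounded below by one positive constant, all $v_0^j,v_1^j$ are bounded above by one finite constant, and $\eta_1^A+\eta_0^A$ stays bounded. Then $(T_G^*,D_G^*)\in\Delta_m(\alpha,\beta)$ still holds, and, when the streams are i.i.d.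 as in (2), $$E_A(T_G^*)\sim\frac{|\log(\alpha\wedge\beta)|}{\eta_1^A+\eta_0^A};$$ if moreover $J\,(\alpha\vee\beta)\to0$, then also $$\frac{|\log(\alpha\wedge\beta)|}{\eta_1^A+\eta_0^A}\sim\inf_{(T,D)\in\Delta_m(\alpha,\beta)}E_A(T).$$ -/

import Mathlib

open MeasureTheory ProbabilityTheory Filter Topology Asymptotics
open scoped ENNReal

universe u v

noncomputable section

namespace SeqTest

/-- The first `n` observations `(X_1, …, X_n)` of a stream `x = (X_1, X_2, …)`; the observation
at time `i + 1` is the coordinate `x i`. -/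
def firstObs {E : Type u} (n : ℕ) (x : ℕ → E) : Fin n → E := fun i => x i

/-- The log-likelihood ratio at time `n` of a stream with null law `P₀` and alternative law `P₁`:
the logarithm of the density of the law of `(X_1, …, X_n)` under `P₁` with respect to its law
under `P₀`, evaluated at the observations. -/
def streamLLR {E : Type u} [MeasurableSpace E] (P₀ P₁ : Measure (ℕ → E)) (n : ℕ)
    (x : ℕ → E) : ℝ :=
  llr (P₁.map (firstObs n)) (P₀.map (firstObs n)) (firstObs n x)

/-- `J` data streams, each with a simple null hypothesis `P₀ j` and a simple alternative `P₁ j`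
for the law of the whole stream.  The two laws are distinct, mutually absolutely continuous on the
first `n` observations for each `n`, and the log-likelihood ratio tends to `-∞` almost surely under
the null and to `+∞` almost surely under the alternative. -/
structure StreamModel (J : ℕ) where
  /-- observation space of the stream `j` -/
  E : Fin J → Type u
  mE : ∀ j, MeasurableSpace (E j)
  /-- law of the stream `j` under the null hypothesis -/
  P₀ : ∀ j, Measure (ℕ → E j)
  /-- law of the stream `j` under the alternative hypothesis -/
  P₁ : ∀ j, Measure (ℕ → E j)
  prob₀ : ∀ j, IsProbabilityMeasure (P₀ j)
  prob₁ : ∀ j, IsProbabilityMeasure (P₁ j)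
  distinct : ∀ j, P₀ j ≠ P₁ j
  ac₀₁ : ∀ j n, (P₀ j).map (firstObs n) ≪ (P₁ j).map (firstObs n)
  ac₁₀ : ∀ j n, (P₁ j).map (firstObs n) ≪ (P₀ j).map (firstObs n)
  llr_null : ∀ j, ∀ᵐ x ∂(P₀ j), Tendsto (fun n => streamLLR (P₀ j) (P₁ j) n x) atTop atBot
  llr_alt : ∀ j, ∀ᵐ x ∂(P₁ j), Tendsto (fun n => streamLLR (P₀ j) (P₁ j) n x) atTop atTop

attribute [instance] StreamModel.mE StreamModel.prob₀ StreamModel.prob₁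

variable {J : ℕ}

/-- A process of independent and identically distributed observations. -/
def IIDLaw {E : Type u} [MeasurableSpace E] (P : Measure (ℕ → E)) : Prop :=
  iIndepFun (fun (i : ℕ) (x : ℕ → E) => x i) P ∧
    ∀ i : ℕ, IdentDistrib (fun x : ℕ → E => x i) (fun x : ℕ → E => x 0) P P

namespace StreamModel

/-- Sample space of all streams together. -/
abbrev Ω (M : StreamModel.{u} J) : Type u := ∀ j, ℕ → M.E j

/-- The law of the streams when `A` is the set of signals: the streams are independent, the stream
`j` has its alternative law for `j ∈ A` and its null law otherwise. -/
def P (M : StreamModel.{u} J) (A : Finset (Fin J)) : Measure M.Ω :=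
  Measure.pi fun j => if j ∈ A then M.P₁ j else M.P₀ j

/-- `σ_n`, generated by the first `n` observations of all streams. -/
def σ (M : StreamModel.{u} J) : Filtration ℕ (inferInstance : MeasurableSpace M.Ω) where
  seq n := MeasurableSpace.comap (fun (ω : M.Ω) (j : Fin J) => firstObs n (ω j)) inferInstance
  mono' := by
    intro a b hab
    have h : (fun (ω : M.Ω) (j : Fin J) => firstObs a (ω j)) =
        (fun (y : ∀ j, Fin b → M.E j) (j : Fin J) (i : Fin a) => y j (Fin.castLE hab i)) ∘
          (fun (ω : M.Ω) (j : Fin J) => firstObs b (ω j)) := by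
      funext ω j i
      rfl
    change MeasurableSpace.comap _ _ ≤ MeasurableSpace.comap _ _
    rw [h, ← MeasurableSpace.comap_comp]
    refine MeasurableSpace.comap_mono (Measurable.comap_le ?_)
    fun_prop
  le' n := by
    refine Measurable.comap_le ?_
    unfold firstObs
    fun_prop

/-- `λ^j(n)`, the log-likelihood ratio of the stream `j` at time `n`. -/
def Λ (M : StreamModel.{u} J) (n : ℕ) (ω : M.Ω) (j : Fin J) : ℝ :=
  streamLLR (M.P₀ j) (M.P₁ j) n (ω j)

/-- Each stream is i.i.d. under its null and under its alternative law. -/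
def IsIID (M : StreamModel.{u} J) : Prop := ∀ j, IIDLaw (M.P₀ j) ∧ IIDLaw (M.P₁ j)

/-- Kullback–Leibler information number `I_0^j` (for one observation). -/
def I₀ (M : StreamModel.{u} J) (j : Fin J) : ℝ := ∫ x, -streamLLR (M.P₀ j) (M.P₁ j) 1 x ∂(M.P₀ j)

/-- Kullback–Leibler information number `I_1^j` (for one observation). -/
def I₁ (M : StreamModel.{u} J) (j : Fin J) : ℝ := ∫ x, streamLLR (M.P₀ j) (M.P₁ j) 1 x ∂(M.P₁ j)

/-- The integrals defining the information numbers are finite. -/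
def FiniteInformation (M : StreamModel.{u} J) : Prop :=
  ∀ j, Integrable (streamLLR (M.P₀ j) (M.P₁ j) 1) (M.P₀ j) ∧
    Integrable (streamLLR (M.P₀ j) (M.P₁ j) 1) (M.P₁ j)

/-- The variance `v_0^j` of one log-likelihood ratio under the null, as an element of `[0,∞]`. -/
def v₀ (M : StreamModel.{u} J) (j : Fin J) : ℝ≥0∞ :=
  evariance (streamLLR (M.P₀ j) (M.P₁ j) 1) (M.P₀ j)

/-- The variance `v_1^j` of one log-likelihood ratio under the alternative, in `[0,∞]`. -/
def v₁ (M : StreamModel.{u} J) (j : Fin J) : ℝ≥0∞ :=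
  evariance (streamLLR (M.P₀ j) (M.P₁ j) 1) (M.P₁ j)

/-- `η_0^A = min_{j ∉ A} I_0^j` (used for `A ≠ [J]`). -/
def η₀ (M : StreamModel.{u} J) (A : Finset (Fin J)) : ℝ := ⨅ j : {j // j ∉ A}, M.I₀ j

/-- `η_1^A = min_{j ∈ A} I_1^j` (used for `A ≠ ∅`). -/
def η₁ (M : StreamModel.{u} J) (A : Finset (Fin J)) : ℝ := ⨅ j : {j // j ∈ A}, M.I₁ j

/-- A stopping rule (with value `⊤` if sampling never stops) together with the set of rejected
null hypotheses. -/
abbrev Rule (M : StreamModel.{u} J) : Type u := (M.Ω → WithTop ℕ) × (M.Ω → Finset (Fin J))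

/-- `(T, D)` is a sequential test: `T` is a stopping time of `(σ_n)` and `D` is `σ_T`-measurable. -/
def IsTest (M : StreamModel.{u} J) (p : M.Rule) : Prop :=
  ∃ hT : IsStoppingTime M.σ p.1, ∀ j, MeasurableSet[hT.measurableSpace] {ω | j ∈ p.2 ω}

/-- Expected sample size `E_A(T)`, in `[0,∞]`. -/
def expTime (M : StreamModel.{u} J) (A : Finset (Fin J)) (T : M.Ω → WithTop ℕ) : ℝ≥0∞ :=
  ∫⁻ ω, ENat.toENNReal (T ω) ∂(M.P A)

/-- `pFDR_A = E_A(V / R | R ≥ 1)`, where `R = |D|` and `V = |D \ A|`. -/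
def pFDR (M : StreamModel.{u} J) (A : Finset (Fin J)) (D : M.Ω → Finset (Fin J)) : ℝ :=
  ∫ ω, ((D ω \ A).card : ℝ) / ((D ω).card : ℝ) ∂(cond (M.P A) {ω | 1 ≤ (D ω).card})

/-- `pFNR_A = E_A(W / (J - R) | J - R ≥ 1)`, where `J - R = |Dᶜ|` and `W = |A \ D|`. -/
def pFNR (M : StreamModel.{u} J) (A : Finset (Fin J)) (D : M.Ω → Finset (Fin J)) : ℝ :=
  ∫ ω, ((A \ D ω).card : ℝ) / ((D ω)ᶜ.card : ℝ) ∂(cond (M.P A) {ω | 1 ≤ (D ω)ᶜ.card})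

/-- The class `Δ` of the sequential tests that, for each signal set in the class `S`, terminate
almost surely and have pFDR (defined and) at most `α` and pFNR (defined and) at most `β`. -/
def control (M : StreamModel.{u} J) (S : Set (Finset (Fin J))) (α β : ℝ) : Set M.Rule :=
  {p | M.IsTest p ∧ ∀ A ∈ S,
    (∀ᵐ ω ∂(M.P A), p.1 ω ≠ ⊤) ∧
    M.P A {ω | 1 ≤ (p.2 ω).card} ≠ 0 ∧ M.pFDR A p.2 ≤ α ∧
    M.P A {ω | 1 ≤ (p.2 ω)ᶜ.card} ≠ 0 ∧ M.pFNR A p.2 ≤ β}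

end StreamModel

/-- The signal sets with exactly `m` signals. -/
def signalClass (J m : ℕ) : Set (Finset (Fin J)) := {A | A.card = m}

/-- Ranking of the indices by decreasing value of `f`, ties broken by index:
`ranking f k` is the index of the `(k+1)`-st largest value. -/
def ranking (f : Fin J → ℝ) : Equiv.Perm (Fin J) := Tuple.sort fun j => -f j

/-- The `k`-th largest value `f^{(k)}`, for `1 ≤ k ≤ J`. -/
def orderStat (f : Fin J → ℝ) (k : ℕ) : ℝ :=
  if h : k - 1 < J then f (ranking f ⟨k - 1, h⟩) else 0

/-- The indices `i_1, …, i_m` of the `m` largest values. -/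
def topSet (f : Fin J → ℝ) (m : ℕ) : Finset (Fin J) :=
  (Finset.univ.filter fun k : Fin J => (k : ℕ) < m).map (ranking f).toEmbedding

namespace StreamModel

/-- Stopping time of the gap rule: the first `n ≥ 1` with `λ^{(m)}(n) - λ^{(m+1)}(n) ≥ c`. -/
def gapT (M : StreamModel.{u} J) (m : ℕ) (c : ℝ) : M.Ω → WithTop ℕ :=
  hittingAfter (fun n ω => orderStat (M.Λ n ω) m - orderStat (M.Λ n ω) (m + 1)) (Set.Ici c) 1

/-- The gap rule with `m` signals and threshold `c`: at the stopping time reject the `m` nulls with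
the largest statistics.  (If sampling never stops, the time `0` ranking is used by convention.) -/
def gapRule (M : StreamModel.{u} J) (m : ℕ) (c : ℝ) : M.Rule :=
  (M.gapT m c, fun ω => topSet (M.Λ ((M.gapT m c ω).untopD 0) ω) m)

end StreamModel

/-- The threshold `|log(α ∧ β)| + log(m (J - m))`. -/
def threshold (J m : ℕ) (α β : ℝ) : ℝ :=
  |Real.log (min α β)| + Real.log ((m : ℝ) * ((J : ℝ) - (m : ℝ)))

namespace StreamModel

/-- The gap rule at levels `α, β`. -/
def gapStar (M : StreamModel.{u} J) (m : ℕ) (α β : ℝ) : M.Rule :=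
  M.gapRule m (threshold J m α β)

/-- The first-order optimal sample size `|log(α ∧ β)| / (η_1^A + η_0^A)`. -/
def rate (M : StreamModel.{u} J) (A : Finset (Fin J)) (α β : ℝ) : ℝ :=
  |Real.log (min α β)| / (M.η₁ A + M.η₀ A)

/-- Infimum of `E_A(T)` over the sequential tests that control pFDR and pFNR at `α, β` for all
signal sets with `m` elements. -/
def optTime (M : StreamModel.{u} J) (m : ℕ) (A : Finset (Fin J)) (α β : ℝ) : ℝ≥0∞ :=
  ⨅ p ∈ M.control (signalClass J m) α β, M.expTime A p.1

end StreamModel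

end SeqTest

end

namespace MeasureTheory

theorem lintegral_pi_prod {ι : Type*} [Fintype ι] {X : ι → Type*} [∀ i, MeasurableSpace (X i)]
    (ν : ∀ i, Measure (X i)) [∀ i, IsProbabilityMeasure (ν i)] {f : ∀ i, X i → ℝ≥0∞}
    (hf : ∀ i, Measurable (f i)) :
    ∫⁻ y, ∏ i, f i (y i) ∂(Measure.pi ν) = ∏ i, ∫⁻ x, f i x ∂(ν i) := by
  rw [lintegral_prod_eq_prod_lintegral_of_indepFun Finset.univ (fun i (y : ∀ i, X i) => f i (y i))
    (iIndepFun_pi fun i => (hf i).aemeasurable) (fun i => (hf i).comp (measurable_pi_apply i))]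
  refine Finset.prod_congr rfl fun i _ => ?_
  rw [← (measurePreserving_eval ν i).map_eq, lintegral_map (hf i) (measurable_pi_apply i)]

theorem Measure.pi_withDensity {ι : Type*} [Fintype ι] {X : ι → Type*}
    [∀ i, MeasurableSpace (X i)]
    (ν : ∀ i, Measure (X i)) [∀ i, IsProbabilityMeasure (ν i)] {f : ∀ i, X i → ℝ≥0∞}
    (hf : ∀ i, Measurable (f i)) [∀ i, SigmaFinite ((ν i).withDensity (f i))] :
    Measure.pi (fun i => (ν i).withDensity (f i)) =
      (Measure.pi ν).withDensity (fun y => ∏ i, f i (y i)) := by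
  refine Measure.pi_eq fun s hs => ?_
  rw [withDensity_apply _ (MeasurableSet.univ_pi hs), ← lintegral_indicator (MeasurableSet.univ_pi hs)]
  have h : (Set.univ.pi s).indicator (fun y : ∀ i, X i => ∏ i, f i (y i)) =
      fun y => ∏ i, (s i).indicator (f i) (y i) := by
    classical
    funext y
    by_cases hy : y ∈ Set.univ.pi s
    · rw [Set.indicator_of_mem hy]
      refine Finset.prod_congr rfl fun i _ => ?_
      rw [Set.indicator_of_mem (hy i (Set.mem_univ i))]
    · rw [Set.indicator_of_notMem hy]
      simp only [Set.mem_univ_pi, not_forall] at hy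
      obtain ⟨i, hi⟩ := hy
      exact (Finset.prod_eq_zero (Finset.mem_univ i) (Set.indicator_of_notMem hi _)).symm
  rw [h, lintegral_pi_prod ν fun i => (hf i).indicator (hs i)]
  refine Finset.prod_congr rfl fun i _ => ?_
  rw [lintegral_indicator (hs i), withDensity_apply _ (hs i)]

theorem withDensity_ofReal_exp_llr {X : Type*} [MeasurableSpace X] {μ ν : Measure X}
    [IsProbabilityMeasure μ] [IsProbabilityMeasure ν] (hμν : μ ≪ ν) (hνμ : ν ≪ μ) :
    ν.withDensity (fun x => ENNReal.ofReal (Real.exp (llr μ ν x))) = μ := by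
  rw [← Measure.withDensity_rnDeriv_eq _ _ hμν]
  refine withDensity_congr_ae ?_
  rw [Measure.withDensity_rnDeriv_eq _ _ hμν]
  filter_upwards [exp_llr_of_ac' μ ν hνμ, Measure.rnDeriv_lt_top μ ν] with x hx hx'
  rw [hx, ENNReal.ofReal_toReal hx'.ne]

theorem withDensity_ofReal_exp_neg_llr {X : Type*} [MeasurableSpace X] {μ ν : Measure X}
    [IsProbabilityMeasure μ] [IsProbabilityMeasure ν] (hμν : μ ≪ ν) (hνμ : ν ≪ μ) :
    μ.withDensity (fun x => ENNReal.ofReal (Real.exp (-llr μ ν x))) = ν := by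
  conv_rhs => rw [← withDensity_ofReal_exp_llr hνμ hμν]
  refine withDensity_congr_ae ?_
  filter_upwards [neg_llr hμν] with x hx
  rw [← hx, Pi.neg_apply]

/-- The log-likelihood ratio of two finite products is the sum of those of the factors. -/
theorem llr_pi {ι X : Type*} [Fintype ι] [MeasurableSpace X] {μ ν : Measure X}
    [IsProbabilityMeasure μ] [IsProbabilityMeasure ν] (hμν : μ ≪ ν) (hνμ : ν ≪ μ) :
    llr (Measure.pi fun _ : ι => μ) (Measure.pi fun _ : ι => ν) =ᵐ[Measure.pi fun _ : ι => ν]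
      fun y => ∑ i, llr μ ν (y i) := by
  have hm : Measurable fun x => ENNReal.ofReal (Real.exp (llr μ ν x)) := by fun_prop
  have h : (Measure.pi fun _ : ι => μ) = (Measure.pi fun _ : ι => ν).withDensity
      (fun y => ∏ i, ENNReal.ofReal (Real.exp (llr μ ν (y i)))) := by
    have hd := withDensity_ofReal_exp_llr hμν hνμ
    have : ∀ i : ι, SigmaFinite
        (ν.withDensity (fun x => ENNReal.ofReal (Real.exp (llr μ ν x)))) := by
      intro i; rw [hd]; infer_instance
    rw [← Measure.pi_withDensity (fun _ => ν) (fun _ => hm), hd]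
  rw [h]
  filter_upwards [Measure.rnDeriv_withDensity (Measure.pi fun _ : ι => ν)
    (f := fun y => ∏ i, ENNReal.ofReal (Real.exp (llr μ ν (y i)))) (by fun_prop)] with y hy
  rw [llr, hy, ENNReal.toReal_prod, Real.log_prod]
  · simp [ENNReal.toReal_ofReal (Real.exp_nonneg _)]
  · intro i _
    rw [ENNReal.toReal_ofReal (Real.exp_nonneg _)]
    exact (Real.exp_pos _).ne'

end MeasureTheory

namespace SeqTest

theorem measurable_firstObs {E : Type u} [MeasurableSpace E] (n : ℕ) :
    Measurable (firstObs (E := E) n) := by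
  unfold firstObs; fun_prop

namespace StreamModel

variable {J : ℕ}

/-- The law of the stream `j` when `A` is the set of signals. -/
noncomputable def law (M : StreamModel.{u} J) (A : Finset (Fin J)) (j : Fin J) :
    Measure (ℕ → M.E j) :=
  if j ∈ A then M.P₁ j else M.P₀ j

instance (M : StreamModel.{u} J) (A : Finset (Fin J)) (j : Fin J) :
    IsProbabilityMeasure (M.law A j) := by
  unfold law; split_ifs <;> infer_instance

theorem P_eq_pi_law (M : StreamModel.{u} J) (A : Finset (Fin J)) : M.P A = Measure.pi (M.law A) :=
  rfl

instance (M : StreamModel.{u} J) (A : Finset (Fin J)) : IsProbabilityMeasure (M.P A) := by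
  rw [P_eq_pi_law]; infer_instance

theorem measurePreserving_eval_P (M : StreamModel.{u} J) (A : Finset (Fin J)) (j : Fin J) :
    MeasurePreserving (fun ω : M.Ω => ω j) (M.P A) (M.law A j) :=
  measurePreserving_eval _ j

/-- Sign with which the log-likelihood ratio of the stream `j` enters `dP_B / dP_A`. -/
noncomputable def lrSign (A B : Finset (Fin J)) (j : Fin J) : ℝ :=
  (if j ∈ B then 1 else 0) - (if j ∈ A then 1 else 0)

theorem measure_eq_setLIntegral (M : StreamModel.{u} J) (A B : Finset (Fin J)) (n : ℕ)
    {F : Set M.Ω} (hF : MeasurableSet[M.σ n] F) :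
    M.P B F = ∫⁻ ω in F, ENNReal.ofReal (Real.exp (∑ j, lrSign A B j * M.Λ n ω j)) ∂(M.P A) := by
  obtain ⟨F', hF', rfl⟩ := hF
  have hΦ : Measurable (fun (ω : M.Ω) (j : Fin J) => firstObs n (ω j)) := by
    unfold firstObs; fun_prop
  let f : ∀ j, (Fin n → M.E j) → ℝ≥0∞ := fun j y => ENNReal.ofReal (Real.exp (lrSign A B j *
    llr ((M.P₁ j).map (firstObs n)) ((M.P₀ j).map (firstObs n)) y))
  have hf : ∀ j, Measurable (f j) := fun j => by fun_prop
  have hp₀ : ∀ j, IsProbabilityMeasure ((M.P₀ j).map (firstObs n)) := fun j =>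
    Measure.isProbabilityMeasure_map (measurable_firstObs n).aemeasurable
  have hp₁ : ∀ j, IsProbabilityMeasure ((M.P₁ j).map (firstObs n)) := fun j =>
    Measure.isProbabilityMeasure_map (measurable_firstObs n).aemeasurable
  have hp : ∀ C j, IsProbabilityMeasure ((M.law C j).map (firstObs n)) := fun C j =>
    Measure.isProbabilityMeasure_map (measurable_firstObs n).aemeasurable
  have hmap : ∀ C, (M.P C).map (fun (ω : M.Ω) (j : Fin J) => firstObs n (ω j)) =
      Measure.pi fun j => (M.law C j).map (firstObs n) := fun C => by
    rw [P_eq_pi_law]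
    exact Measure.pi_map_pi fun j => (measurable_firstObs n).aemeasurable
  have hd : ∀ j, ((M.law A j).map (firstObs n)).withDensity (f j) =
      (M.law B j).map (firstObs n) := by
    intro j
    by_cases hA : j ∈ A <;> by_cases hB : j ∈ B <;>
      simp only [law, hA, hB, if_true, if_false, f, lrSign, sub_self, zero_mul, Real.exp_zero,
        ENNReal.ofReal_one, zero_sub, sub_zero, one_mul, neg_mul]
    · exact withDensity_one
    · exact withDensity_ofReal_exp_neg_llr (M.ac₁₀ j n) (M.ac₀₁ j n)
    · exact withDensity_ofReal_exp_llr (M.ac₁₀ j n) (M.ac₀₁ j n)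
    · exact withDensity_one
  have hs : ∀ j, SigmaFinite (((M.law A j).map (firstObs n)).withDensity (f j)) := by
    intro j; rw [hd]; infer_instance
  have hBA := Measure.pi_withDensity (fun j => (M.law A j).map (firstObs n)) hf
  simp only [hd] at hBA
  rw [← Measure.map_apply hΦ hF', hmap B, hBA, withDensity_apply _ hF', ← hmap A,
    setLIntegral_map hF' (by fun_prop) hΦ]
  refine lintegral_congr fun ω => ?_
  simp only [f, Λ, streamLLR]
  rw [← ENNReal.ofReal_prod_of_nonneg fun _ _ => Real.exp_nonneg _, Real.exp_sum]

theorem sum_lrSign_swap {A : Finset (Fin J)} {i j : Fin J} (hi : i ∈ A) (hj : j ∉ A)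
    (f : Fin J → ℝ) : ∑ k, lrSign A (insert j (A.erase i)) k * f k = f j - f i := by
  have hij : i ≠ j := fun h => hj (h ▸ hi)
  have h : ∀ k, lrSign A (insert j (A.erase i)) k * f k =
      (if k = j then f k else 0) - (if k = i then f k else 0) := by
    intro k
    by_cases h1 : k = j
    · subst h1; simp [lrSign, hj, hij.symm]
    · by_cases h2 : k = i
      · subst h2; simp [lrSign, hi, hij]
      · simp [lrSign, h1, h2]
  rw [Finset.sum_congr rfl fun k _ => h k, Finset.sum_sub_distrib]
  simp

theorem measure_swap_eq (M : StreamModel.{u} J) {A : Finset (Fin J)} {i j : Fin J} (hi : i ∈ A)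
    (hj : j ∉ A) (n : ℕ) {F : Set M.Ω} (hF : MeasurableSet[M.σ n] F) :
    M.P (insert j (A.erase i)) F =
      ∫⁻ ω in F, ENNReal.ofReal (Real.exp (-(M.Λ n ω i - M.Λ n ω j))) ∂(M.P A) := by
  rw [M.measure_eq_setLIntegral A _ n hF]
  refine lintegral_congr fun ω => ?_
  rw [sum_lrSign_swap hi hj, neg_sub]

theorem measurable_Λ (M : StreamModel.{u} J) (n : ℕ) : Measurable[M.σ n] (M.Λ n) := by
  have : M.Λ n = (fun (y : ∀ j, Fin n → M.E j) (j : Fin J) =>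
      llr ((M.P₁ j).map (firstObs n)) ((M.P₀ j).map (firstObs n)) (y j)) ∘
      (fun (ω : M.Ω) (j : Fin J) => firstObs n (ω j)) := rfl
  rw [this]
  exact Measurable.comp (by fun_prop) (comap_measurable _)

end StreamModel

end SeqTest

namespace SeqTest

section Ordering

variable {J : ℕ} {f : Fin J → ℝ} {m : ℕ}

theorem apply_ranking_antitone (f : Fin J → ℝ) : Antitone fun k => f (ranking f k) := by
  intro k l hkl
  have := Tuple.monotone_sort (fun j => -f j) hkl
  simpa [ranking] using this

theorem mem_topSet {i : Fin J} : i ∈ topSet f m ↔ ((ranking f).symm i : ℕ) < m := by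
  simp only [topSet, Finset.mem_map, Finset.mem_filter, Finset.mem_univ, true_and,
    Equiv.coe_toEmbedding]
  constructor
  · rintro ⟨k, hk, rfl⟩; simpa using hk
  · intro h; exact ⟨_, h, by simp⟩

theorem card_topSet (f : Fin J → ℝ) (hm : m ≤ J) : (topSet f m).card = m := by
  rw [topSet, Finset.card_map, Fin.card_filter_val_lt, min_eq_right hm]

theorem le_of_mem_topSet {i j : Fin J} (hi : i ∈ topSet f m) (hj : j ∉ topSet f m) :
    f j ≤ f i := by
  rw [mem_topSet] at hi hj
  have h := apply_ranking_antitone f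
    (show (ranking f).symm i ≤ (ranking f).symm j from Fin.le_def.2 (by omega))
  simpa using h

theorem orderStat_sub_le (hm : 1 ≤ m) {i j : Fin J}
    (hi : i ∈ topSet f m) (hj : j ∉ topSet f m) :
    orderStat f m - orderStat f (m + 1) ≤ f i - f j := by
  rw [mem_topSet] at hi hj
  have h1 : m - 1 < J := by omega
  have h2 : m + 1 - 1 < J := by omega
  rw [orderStat, dif_pos h1, orderStat, dif_pos h2]
  have e1 := apply_ranking_antitone f
    (show (ranking f).symm i ≤ ⟨m - 1, h1⟩ from Fin.le_def.2 (by simp only; omega))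
  have e2 := apply_ranking_antitone f
    (show ⟨m + 1 - 1, h2⟩ ≤ (ranking f).symm j from Fin.le_def.2 (by simp only; omega))
  simp only [Equiv.apply_symm_apply] at e1 e2
  linarith

theorem topSet_eq_of_lt {A : Finset (Fin J)} (hA : A.card = m) (hmJ : m ≤ J)
    (h : ∀ i ∈ A, ∀ j, j ∉ A → f j < f i) : topSet f m = A := by
  symm
  refine Finset.eq_of_subset_of_card_le ?_ (by rw [card_topSet f hmJ, hA])
  by_contra hsub
  obtain ⟨i, hi, hi'⟩ := Finset.not_subset.1 hsub
  have : ¬ topSet f m ⊆ A := fun hs =>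
    hi' (Finset.eq_of_subset_of_card_le hs (by rw [card_topSet f hmJ, hA]) ▸ hi)
  obtain ⟨j, hj, hj'⟩ := Finset.not_subset.1 this
  exact (h i hi j hj').not_ge (le_of_mem_topSet hj hi')

theorem le_orderStat_sub {A : Finset (Fin J)} (hA : A.card = m) (hm : 1 ≤ m) (hmJ : m ≤ J - 1)
    {c : ℝ} (hc : 0 < c) (h : ∀ i ∈ A, ∀ j, j ∉ A → c ≤ f i - f j) :
    c ≤ orderStat f m - orderStat f (m + 1) := by
  have htop : topSet f m = A := topSet_eq_of_lt hA (by omega) fun i hi j hj => by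
    linarith [h i hi j hj]
  have h1 : m - 1 < J := by omega
  have h2 : m + 1 - 1 < J := by omega
  rw [orderStat, dif_pos h1, orderStat, dif_pos h2]
  refine h _ ?_ _ ?_
  · rw [← htop, mem_topSet]; simp; omega
  · rw [← htop, mem_topSet]; simp

theorem measurableSet_ranking_eq (r : Equiv.Perm (Fin J)) :
    MeasurableSet {f : Fin J → ℝ | ranking f = r} := by
  have : {f : Fin J → ℝ | ranking f = r} = ⋂ i : Fin J, ⋂ j : Fin J,
      {f : Fin J → ℝ | (i ≤ j → f (r j) ≤ f (r i)) ∧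
        (i < j → f (r i) = f (r j) → r i < r j)} := by
    ext f
    simp only [ranking, eq_comm (b := r), Tuple.eq_sort_iff, Set.mem_ofPred_eq, Set.mem_iInter,
      Monotone, Function.comp, neg_le_neg_iff, neg_inj]
    constructor
    · rintro ⟨h1, h2⟩ i j; exact ⟨fun h => h1 h, h2 i j⟩
    · intro h; exact ⟨fun i j hij => (h i j).1 hij, fun i j => (h i j).2⟩
  rw [this]
  refine MeasurableSet.iInter fun i => MeasurableSet.iInter fun j => MeasurableSet.inter ?_ ?_
  · exact MeasurableSet.imp (MeasurableSet.const _)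
      (measurableSet_le (measurable_pi_apply _) (measurable_pi_apply _))
  · exact MeasurableSet.imp (MeasurableSet.const _)
      (MeasurableSet.imp (measurableSet_eq_fun (measurable_pi_apply _) (measurable_pi_apply _))
        (MeasurableSet.const _))

theorem measurable_orderStat (k : ℕ) : Measurable fun f : Fin J → ℝ => orderStat f k := by
  by_cases h : k - 1 < J
  · have : (fun f : Fin J → ℝ => orderStat f k) = fun f => ∑ r : Equiv.Perm (Fin J),
        {f : Fin J → ℝ | ranking f = r}.indicator (fun f => f (r ⟨k - 1, h⟩)) f := by
      funext f
      rw [Finset.sum_eq_single (ranking f)]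
      · simp [orderStat, h]
      · intro r _ hr
        exact Set.indicator_of_notMem (fun hf => hr hf.symm) _
      · simp
    rw [this]
    exact Finset.measurable_sum _ fun r _ =>
      (measurable_pi_apply _).indicator (measurableSet_ranking_eq r)
  · simp only [orderStat, h, dif_neg, not_false_eq_true]; exact measurable_const

theorem measurableSet_mem_topSet (m : ℕ) (j : Fin J) :
    MeasurableSet {f : Fin J → ℝ | j ∈ topSet f m} := by
  have : {f : Fin J → ℝ | j ∈ topSet f m} = ⋃ r : Equiv.Perm (Fin J),
      {f : Fin J → ℝ | ranking f = r} ∩ {_f | (r.symm j : ℕ) < m} := by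
    ext f; simp [mem_topSet]
  rw [this]
  exact MeasurableSet.iUnion fun r => (measurableSet_ranking_eq r).inter (MeasurableSet.const _)

theorem card_sdiff_le_sum {A D : Finset (Fin J)} (h : D.card = A.card) :
    ((D \ A).card : ℝ) ≤ ∑ i ∈ A, ∑ j ∈ Aᶜ, (if i ∉ D ∧ j ∈ D then 1 else 0) := by
  have e : ∑ i ∈ A, ∑ j ∈ Aᶜ, (if i ∉ D ∧ j ∈ D then (1 : ℝ) else 0) =
      ((A \ D).card : ℝ) * ((D \ A).card : ℝ) := by
    have h1 : ∀ i j, (if i ∉ D ∧ j ∈ D then (1 : ℝ) else 0) =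
        (if i ∉ D then 1 else 0) * (if j ∈ D then 1 else 0) := by
      intro i j; by_cases i ∈ D <;> by_cases j ∈ D <;> simp [*]
    simp_rw [h1]
    rw [← Finset.sum_mul_sum, Finset.sum_boole, Finset.sum_boole]
    congr 3
    · ext; simp
    · ext; simp [and_comm]
  rw [e, Finset.card_sdiff_comm h.symm]
  have : (D \ A).card ≤ (D \ A).card * (D \ A).card := Nat.le_mul_self _
  exact_mod_cast this

end Ordering

namespace StreamModel

variable {J : ℕ} (M : StreamModel.{u} J) {m : ℕ} {c : ℝ}

theorem isStoppingTime_gapT (m : ℕ) (c : ℝ) : IsStoppingTime M.σ (M.gapT m c) := by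
  refine Adapted.isStoppingTime_hittingAfter (fun n => ?_) measurableSet_Ici
  exact ((measurable_orderStat m).sub (measurable_orderStat (m + 1))).comp (M.measurable_Λ n)

theorem le_gap_of_gapT_eq {ω : M.Ω} {n : ℕ} (h : M.gapT m c ω = n) :
    c ≤ orderStat (M.Λ n ω) m - orderStat (M.Λ n ω) (m + 1) := by
  have hne : M.gapT m c ω ≠ ⊤ := by rw [h]; exact WithTop.coe_ne_top
  have h2 : _ ∈ Set.Ici c := hittingAfter_mem_set_of_ne_top hne
  rw [Set.mem_Ici] at h2
  have h3 : (M.gapT m c ω).untopA = n := by rw [h]; rfl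
  change c ≤ orderStat (M.Λ (M.gapT m c ω).untopA ω) m -
    orderStat (M.Λ (M.gapT m c ω).untopA ω) (m + 1) at h2
  rwa [h3] at h2

theorem gapT_le_of_le_gap {ω : M.Ω} {n : ℕ} (hn : 1 ≤ n)
    (h : c ≤ orderStat (M.Λ n ω) m - orderStat (M.Λ n ω) (m + 1)) : M.gapT m c ω ≤ n :=
  hittingAfter_le_of_mem hn h

theorem measurableSet_mem_topSet_Λ (m n : ℕ) (j : Fin J) :
    MeasurableSet[M.σ n] {ω | j ∈ topSet (M.Λ n ω) m} :=
  M.measurable_Λ n (measurableSet_mem_topSet m j)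

theorem measurableSet_of_forall_eq {T : M.Ω → WithTop ℕ} (hT : IsStoppingTime M.σ T) {F : Set M.Ω}
    (hF : ∀ n : ℕ, MeasurableSet[M.σ n] (F ∩ {ω | T ω = n}))
    (hF' : MeasurableSet[⨆ n, M.σ n] (F ∩ {ω | T ω = ⊤})) :
    MeasurableSet[hT.measurableSpace] F := by
  refine ⟨?_, fun n => ?_⟩
  · have : F = (⋃ n : ℕ, F ∩ {ω | T ω = n}) ∪ (F ∩ {ω | T ω = ⊤}) := by
      ext ω
      induction h : T ω using WithTop.recTopCoe <;> simp [h]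
    rw [this]
    exact (MeasurableSet.iUnion fun n =>
      le_iSup (fun n => (M.σ n : MeasurableSpace M.Ω)) n _ (hF n)).union hF'
  · change MeasurableSet[M.σ n] (F ∩ {ω | T ω ≤ (n : WithTop ℕ)})
    have : F ∩ {ω | T ω ≤ (n : WithTop ℕ)} = ⋃ k ∈ Set.Iic n, F ∩ {ω | T ω = k} := by
      ext ω
      induction h : T ω using WithTop.recTopCoe with
      | top => simp [h]
      | coe a => simp [h]
    rw [this]
    exact MeasurableSet.biUnion (Set.to_countable _) fun k hk => M.σ.mono hk _ (hF k)

theorem isTest_gapRule (m : ℕ) (c : ℝ) : M.IsTest (M.gapRule m c) := by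
  refine ⟨M.isStoppingTime_gapT m c, fun j => measurableSet_of_forall_eq _ _ (fun n => ?_) ?_⟩
  · have : {ω | j ∈ (M.gapRule m c).2 ω} ∩ {ω | (M.gapRule m c).1 ω = n} =
        {ω | j ∈ topSet (M.Λ n ω) m} ∩ {ω | M.gapT m c ω = n} := by
      ext ω
      simp only [gapRule, Set.mem_inter_iff, Set.mem_ofPred_eq]
      refine and_congr_left fun h => ?_
      rw [h]; rfl
    rw [this]
    exact (M.measurableSet_mem_topSet_Λ m n j).inter
      ((M.isStoppingTime_gapT m c).measurableSet_eq n)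
  · have : {ω | j ∈ (M.gapRule m c).2 ω} ∩ {ω | (M.gapRule m c).1 ω = ⊤} =
        {ω | j ∈ topSet (M.Λ 0 ω) m} ∩ {ω | M.gapT m c ω = ⊤} := by
      ext ω
      simp only [gapRule, Set.mem_inter_iff, Set.mem_ofPred_eq]
      refine and_congr_left fun h => ?_
      rw [h]; rfl
    rw [this]
    exact (le_iSup (fun n => (M.σ n : MeasurableSpace M.Ω)) 0 _
      (M.measurableSet_mem_topSet_Λ m 0 j)).inter
      (M.isStoppingTime_gapT m c).measurableSet_eq_top'

theorem IsTest.measurableSet_mem {M : StreamModel.{u} J} {p : M.Rule} (h : M.IsTest p)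
    (j : Fin J) : MeasurableSet {ω | j ∈ p.2 ω} := by
  obtain ⟨hT, hD⟩ := h
  exact hT.measurableSpace_le _ (hD j)

theorem IsTest.measurable {M : StreamModel.{u} J} {p : M.Rule} (h : M.IsTest p) {X : Type*}
    [MeasurableSpace X] (g : Finset (Fin J) → X) : Measurable fun ω => g (p.2 ω) := by
  let _ : MeasurableSpace (Finset (Fin J)) := ⊤
  have hg : Measurable g := fun _ _ => trivial
  refine hg.comp (measurable_to_countable' fun D => ?_)
  have : p.2 ⁻¹' {D} = ⋂ j : Fin J, {ω | j ∈ p.2 ω ↔ j ∈ D} := by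
    ext ω; simp [Finset.ext_iff]
  rw [this]
  exact MeasurableSet.iInter fun j => (h.measurableSet_mem j).iff (MeasurableSet.const _)

theorem ae_Λ_tendsto (A : Finset (Fin J)) : ∀ᵐ ω ∂(M.P A), ∀ j,
    Tendsto (fun n => M.Λ n ω j) atTop (if j ∈ A then atTop else atBot) := by
  rw [ae_all_iff]
  intro j
  refine (M.measurePreserving_eval_P A j).quasiMeasurePreserving.ae (p := fun x =>
    Tendsto (fun n => streamLLR (M.P₀ j) (M.P₁ j) n x) atTop (if j ∈ A then atTop else atBot)) ?_
  by_cases hj : j ∈ A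
  · simpa [law, hj] using M.llr_alt j
  · simpa [law, hj] using M.llr_null j

theorem ae_gapT_ne_top {A : Finset (Fin J)} (hA : A.card = m) (hm : 1 ≤ m) (hmJ : m ≤ J - 1)
    (hc : 0 < c) : ∀ᵐ ω ∂(M.P A), M.gapT m c ω ≠ ⊤ := by
  filter_upwards [M.ae_Λ_tendsto A] with ω hω
  have h : ∀ᶠ n in atTop, ∀ j, (j ∈ A → c ≤ M.Λ n ω j) ∧ (j ∉ A → M.Λ n ω j ≤ 0) := by
    rw [eventually_all]
    intro j
    have := hω j
    by_cases hj : j ∈ A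
    · simp only [hj, if_true] at this
      filter_upwards [this.eventually_ge_atTop c] with n hn
      simpa [hj] using hn
    · simp only [hj, if_false] at this
      filter_upwards [this.eventually_le_atBot 0] with n hn
      simpa [hj] using hn
  obtain ⟨n, hn, hn1⟩ := (h.and (eventually_ge_atTop 1)).exists
  refine ne_top_of_le_ne_top (WithTop.coe_ne_top (a := n)) (M.gapT_le_of_le_gap hn1 ?_)
  refine le_orderStat_sub hA hm hmJ hc fun i hi j hj => ?_
  linarith [(hn i).1 hi, (hn j).2 hj]

/-- Under the signal set `A`, the gap rule accepts a given signal and rejects a given noise stream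
with probability at most `exp (-c)`. -/
theorem measure_gap_swap_le {A : Finset (Fin J)} (hm : 1 ≤ m) {i j : Fin J}
    (hi : i ∈ A) (hj : j ∉ A) :
    M.P A {ω | M.gapT m c ω ≠ ⊤ ∧ i ∉ (M.gapRule m c).2 ω ∧ j ∈ (M.gapRule m c).2 ω} ≤
      ENNReal.ofReal (Real.exp (-c)) := by
  set B := insert j (A.erase i) with hB
  have hij : i ≠ j := fun h => hj (h ▸ hi)
  have hiB : i ∉ B := by simp [hB, hij]
  have hjB : j ∈ B := by simp [hB]
  have hAB : insert i (B.erase j) = A := by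
    have hj' : j ∉ A.erase i := fun h => hj (Finset.mem_of_mem_erase h)
    rw [hB, Finset.erase_insert hj', Finset.insert_erase hi]
  let G : ℕ → Set M.Ω := fun n => {ω | i ∈ topSet (M.Λ n ω) m}ᶜ ∩
    {ω | j ∈ topSet (M.Λ n ω) m} ∩ {ω | M.gapT m c ω = n}
  have hG : ∀ n, MeasurableSet[M.σ n] (G n) := fun n =>
    (((M.measurableSet_mem_topSet_Λ m n i).compl).inter (M.measurableSet_mem_topSet_Λ m n j)).inter
      ((M.isStoppingTime_gapT m c).measurableSet_eq n)
  have hsub : {ω | M.gapT m c ω ≠ ⊤ ∧ i ∉ (M.gapRule m c).2 ω ∧ j ∈ (M.gapRule m c).2 ω} ⊆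
      ⋃ n, G n := by
    rintro ω ⟨h1, h2, h3⟩
    obtain ⟨n, hn⟩ := WithTop.ne_top_iff_exists.1 h1
    refine Set.mem_iUnion.2 ⟨n, ?_⟩
    simp only [gapRule, ← hn] at h2 h3
    exact ⟨⟨h2, h3⟩, hn.symm⟩
  have hdisj : Pairwise (Function.onFun Disjoint G) := by
    intro a b hab
    refine Set.disjoint_left.2 fun ω ha hb => hab ?_
    have := ha.2.symm.trans hb.2
    exact_mod_cast this
  calc _ ≤ M.P A (⋃ n, G n) := measure_mono hsub
    _ ≤ ∑' n, M.P A (G n) := measure_iUnion_le _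
    _ ≤ ∑' n, ENNReal.ofReal (Real.exp (-c)) * M.P B (G n) := by
        refine ENNReal.tsum_le_tsum fun n => ?_
        rw [← hAB, M.measure_swap_eq hjB hiB n (hG n), ← setLIntegral_const]
        refine setLIntegral_mono' (M.σ.le n _ (hG n)) fun ω hω => ?_
        refine ENNReal.ofReal_le_ofReal (Real.exp_le_exp.2 ?_)
        have h1 := M.le_gap_of_gapT_eq hω.2
        have h2 := orderStat_sub_le hm hω.1.2 hω.1.1
        linarith
    _ = ENNReal.ofReal (Real.exp (-c)) * M.P B (⋃ n, G n) := by
        rw [ENNReal.tsum_mul_left, measure_iUnion hdisj fun n => M.σ.le n _ (hG n)]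
    _ ≤ ENNReal.ofReal (Real.exp (-c)) := by
        exact mul_le_of_le_one_right' prob_le_one

theorem card_gapRule (hmJ : m ≤ J - 1) (c : ℝ) (ω : M.Ω) : ((M.gapRule m c).2 ω).card = m :=
  card_topSet _ (by omega)

theorem integral_card_sdiff_gapRule_le {A : Finset (Fin J)} (hA : A.card = m) (hm : 1 ≤ m)
    (hmJ : m ≤ J - 1) (hc : 0 < c) :
    ∫ ω, (((M.gapRule m c).2 ω \ A).card : ℝ) ∂(M.P A) ≤ m * (J - m) * Real.exp (-c) := by
  have hT := M.isTest_gapRule m c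
  have hint : ∀ g : Finset (Fin J) → ℝ, Integrable (fun ω => g ((M.gapRule m c).2 ω)) (M.P A) := by
    intro g
    refine Integrable.of_bound (hT.measurable g).aestronglyMeasurable (∑ D, ‖g D‖)
      (Eventually.of_forall fun ω => ?_)
    exact Finset.single_le_sum (f := fun D => ‖g D‖) (fun D _ => norm_nonneg _) (Finset.mem_univ _)
  calc _ ≤ ∫ ω, ∑ i ∈ A, ∑ j ∈ Aᶜ, (if i ∉ (M.gapRule m c).2 ω ∧ j ∈ (M.gapRule m c).2 ω
          then (1 : ℝ) else 0) ∂(M.P A) := by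
        refine integral_mono (hint fun D => ((D \ A).card : ℝ))
          (hint fun D => ∑ i ∈ A, ∑ j ∈ Aᶜ, (if i ∉ D ∧ j ∈ D then (1 : ℝ) else 0)) fun ω => ?_
        exact card_sdiff_le_sum (by rw [hA, M.card_gapRule hmJ])
    _ = ∑ i ∈ A, ∑ j ∈ Aᶜ, ∫ ω, (if i ∉ (M.gapRule m c).2 ω ∧ j ∈ (M.gapRule m c).2 ω
          then (1 : ℝ) else 0) ∂(M.P A) := by
        rw [integral_finsetSum _ fun i _ =>
          hint fun D => ∑ j ∈ Aᶜ, (if i ∉ D ∧ j ∈ D then (1 : ℝ) else 0)]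
        refine Finset.sum_congr rfl fun i _ => ?_
        rw [integral_finsetSum _ fun j _ => hint fun D => (if i ∉ D ∧ j ∈ D then (1 : ℝ) else 0)]
    _ ≤ ∑ i ∈ A, ∑ j ∈ Aᶜ, Real.exp (-c) := by
        refine Finset.sum_le_sum fun i hi => Finset.sum_le_sum fun j hj => ?_
        have hset : MeasurableSet {ω | i ∉ (M.gapRule m c).2 ω ∧ j ∈ (M.gapRule m c).2 ω} :=
          (hT.measurableSet_mem i).compl.inter (hT.measurableSet_mem j)
        have : (fun ω => if i ∉ (M.gapRule m c).2 ω ∧ j ∈ (M.gapRule m c).2 ω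
            then (1 : ℝ) else 0) =
            {ω | i ∉ (M.gapRule m c).2 ω ∧ j ∈ (M.gapRule m c).2 ω}.indicator 1 := by
          funext ω; simp [Set.indicator_apply]
        rw [this, integral_indicator_one hset]
        refine ENNReal.toReal_le_of_le_ofReal (Real.exp_nonneg _) (le_trans (measure_mono_ae ?_)
          (M.measure_gap_swap_le hm hi (Finset.mem_compl.1 hj)))
        filter_upwards [M.ae_gapT_ne_top hA hm hmJ hc] with ω hω h
        exact ⟨hω, h⟩
    _ = m * (J - m) * Real.exp (-c) := by
        simp only [Finset.sum_const, Finset.card_compl, Fintype.card_fin, hA, nsmul_eq_mul]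
        rw [Nat.cast_sub (by omega)]; ring

theorem one_le_card_gapRule (hm : 1 ≤ m) (hmJ : m ≤ J - 1) :
    {ω | 1 ≤ ((M.gapRule m c).2 ω).card} = Set.univ ∧
    {ω | 1 ≤ ((M.gapRule m c).2 ω)ᶜ.card} = Set.univ := by
  constructor <;> ext ω <;>
    simp only [Finset.card_compl, Fintype.card_fin, M.card_gapRule hmJ, Set.mem_ofPred_eq,
      Set.mem_univ, iff_true] <;> omega

end StreamModel

theorem exp_neg_threshold {J m : ℕ} (hm : 1 ≤ m) (hmJ : m ≤ J - 1) {α β : ℝ}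
    (hα : α ∈ Set.Ioo (0 : ℝ) 1) (hβ : β ∈ Set.Ioo (0 : ℝ) 1) :
    m * (J - m) * Real.exp (-threshold J m α β) = min α β := by
  have h0 : 0 < min α β := lt_min hα.1 hβ.1
  have h1 : min α β < 1 := (min_le_left _ _).trans_lt hα.2
  have hmJ' : (m : ℝ) + 1 ≤ J := by exact_mod_cast (by omega : m + 1 ≤ J)
  have hm' : (1 : ℝ) ≤ m := by exact_mod_cast hm
  have hJm : (0 : ℝ) < J - m := by linarith
  have hp : (0 : ℝ) < m * (J - m) := mul_pos (by linarith) hJm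
  rw [threshold, abs_of_neg (Real.log_neg h0 h1), neg_add, neg_neg, Real.exp_add,
    Real.exp_log h0, Real.exp_neg, Real.exp_log hp, mul_comm (min α β), mul_inv_cancel_left₀ hp.ne']

theorem threshold_pos {J m : ℕ} (hm : 1 ≤ m) (hmJ : m ≤ J - 1) {α β : ℝ}
    (hα : α ∈ Set.Ioo (0 : ℝ) 1) (hβ : β ∈ Set.Ioo (0 : ℝ) 1) : 0 < threshold J m α β := by
  have h0 : 0 < min α β := lt_min hα.1 hβ.1
  have h1 : min α β < 1 := (min_le_left _ _).trans_lt hα.2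
  have hmJ' : (m : ℝ) + 1 ≤ J := by exact_mod_cast (by omega : m + 1 ≤ J)
  have hm' : (1 : ℝ) ≤ m := by exact_mod_cast hm
  have hp : (1 : ℝ) ≤ m * (J - m) := by nlinarith
  have := Real.log_nonneg hp
  have := abs_pos.2 (Real.log_neg h0 h1).ne
  unfold threshold; linarith

namespace StreamModel

variable {J : ℕ} (M : StreamModel.{u} J) {m : ℕ} {α β : ℝ}

theorem integral_card_sdiff_gapStar_le {A : Finset (Fin J)} (hA : A.card = m) (hm : 1 ≤ m)
    (hmJ : m ≤ J - 1) (hα : α ∈ Set.Ioo (0 : ℝ) 1) (hβ : β ∈ Set.Ioo (0 : ℝ) 1) :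
    ∫ ω, (((M.gapStar m α β).2 ω \ A).card : ℝ) ∂(M.P A) ≤ min α β := by
  rw [← exp_neg_threshold hm hmJ hα hβ]
  exact M.integral_card_sdiff_gapRule_le hA hm hmJ (threshold_pos hm hmJ hα hβ)

theorem gapStar_mem_control (hm : 1 ≤ m) (hmJ : m ≤ J - 1)
    (hα : α ∈ Set.Ioo (0 : ℝ) 1) (hβ : β ∈ Set.Ioo (0 : ℝ) 1) :
    M.gapStar m α β ∈ M.control (signalClass J m) α β := by
  refine ⟨M.isTest_gapRule _ _, fun A hA => ?_⟩
  have hA : A.card = m := hA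
  have hI := M.integral_card_sdiff_gapStar_le hA hm hmJ hα hβ
  have hI0 : 0 ≤ ∫ ω, (((M.gapStar m α β).2 ω \ A).card : ℝ) ∂(M.P A) :=
    integral_nonneg fun ω => Nat.cast_nonneg _
  obtain ⟨hu1, hu2⟩ := M.one_le_card_gapRule (c := threshold J m α β) hm hmJ
  have hcard : ∀ ω, ((M.gapStar m α β).2 ω).card = m := M.card_gapRule hmJ _
  refine ⟨M.ae_gapT_ne_top hA hm hmJ (threshold_pos hm hmJ hα hβ), ?_, ?_, ?_, ?_⟩
  · rw [gapStar, hu1, measure_univ]; exact one_ne_zero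
  · rw [pFDR, gapStar, hu1, cond_univ]
    change ∫ ω, (((M.gapStar m α β).2 ω \ A).card : ℝ) / (((M.gapStar m α β).2 ω).card : ℝ) ∂_ ≤ α
    simp only [hcard, integral_div]
    exact (div_le_self hI0 (by exact_mod_cast hm)).trans (hI.trans (min_le_left _ _))
  · rw [gapStar, hu2, measure_univ]; exact one_ne_zero
  · rw [pFNR, gapStar, hu2, cond_univ]
    change ∫ ω, ((A \ (M.gapStar m α β).2 ω).card : ℝ) /
      (((M.gapStar m α β).2 ω)ᶜ.card : ℝ) ∂_ ≤ β
    have hs : ∀ ω, (A \ (M.gapStar m α β).2 ω).card = ((M.gapStar m α β).2 ω \ A).card :=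
      fun ω => Finset.card_sdiff_comm (by rw [hcard, hA])
    simp only [hs, Finset.card_compl, Fintype.card_fin, hcard, integral_div]
    refine (div_le_self hI0 ?_).trans (hI.trans (min_le_right _ _))
    exact_mod_cast (by omega : 1 ≤ J - m)

end StreamModel

end SeqTest

namespace ProbabilityTheory

theorem Indep.setIntegral_eq {Ω : Type*} {m₁ m₂ mΩ : MeasurableSpace Ω} {μ : Measure Ω}
    (h : Indep m₁ m₂ μ) (h₁ : m₁ ≤ mΩ) (h₂ : m₂ ≤ mΩ) {B : Set Ω} (hB : MeasurableSet[m₁] B)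
    {Z : Ω → ℝ} (hZ : Measurable[m₂] Z) : ∫ ω in B, Z ω ∂μ = μ.real B * ∫ ω, Z ω ∂μ := by
  have hX : Measurable[m₁] (B.indicator (1 : Ω → ℝ)) := by
    refine Measurable.indicator ?_ hB
    exact measurable_const
  have hind : IndepFun (B.indicator (1 : Ω → ℝ)) Z μ := by
    rw [IndepFun_iff_Indep]
    exact indep_of_indep_of_le_left (indep_of_indep_of_le_right h hZ.comap_le) hX.comap_le
  have := hind.integral_fun_mul_eq_mul_integral (hX.mono h₁ le_rfl).aestronglyMeasurable
    (hZ.mono h₂ le_rfl).aestronglyMeasurable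
  rw [integral_indicator_one (h₁ _ hB)] at this
  rw [← this, ← integral_indicator (h₁ _ hB)]
  refine integral_congr_ae (Eventually.of_forall fun ω => ?_)
  by_cases hω : ω ∈ B <;> simp [hω]

end ProbabilityTheory

namespace SeqTest

section Stream

variable {E : Type u} [MeasurableSpace E] {P P₀ P₁ : Measure (ℕ → E)}

theorem IIDLaw.map_firstObs [IsProbabilityMeasure P] (h : IIDLaw P) (n : ℕ) :
    P.map (firstObs n) = Measure.pi fun _ : Fin n => P.map fun x => x 0 := by
  have h1 : iIndepFun (fun (i : Fin n) (x : ℕ → E) => x i) P :=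
    h.1.precomp (g := fun i : Fin n => (i : ℕ)) Fin.val_injective
  have h2 := (iIndepFun_iff_map_fun_eq_pi_map
    (fun i => (measurable_pi_apply _).aemeasurable)).1 h1
  refine h2.trans ?_
  congr 1
  funext i
  exact (h.2 i).map_eq

theorem IIDLaw.identDistrib_shift (h : IIDLaw P) (s : ℕ) :
    IdentDistrib (fun (x : ℕ → E) (i : ℕ) => x (s + i)) (fun x => x) P P :=
  IdentDistrib.pi (X := fun i (x : ℕ → E) => x (s + i)) (Y := fun i (x : ℕ → E) => x i)
    (fun i => (h.2 (s + i)).trans (h.2 i).symm)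
    (h.1.precomp (add_right_injective s)) h.1

/-- The log-likelihood ratio of one observation. -/
noncomputable def stepLLR (P₀ P₁ : Measure (ℕ → E)) : E → ℝ :=
  llr (P₁.map fun x => x 0) (P₀.map fun x => x 0)

@[fun_prop]
theorem measurable_stepLLR : Measurable (stepLLR P₀ P₁) := measurable_llr _ _

theorem map_zero_ac {Q : Measure (ℕ → E)} (h : P.map (firstObs 1) ≪ Q.map (firstObs 1)) :
    (P.map fun x => x 0) ≪ Q.map fun x => x 0 := by
  have e : ∀ R : Measure (ℕ → E), (R.map fun x => x 0) =
      (R.map (firstObs 1)).map fun y => y 0 := fun R => by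
    rw [Measure.map_map (measurable_pi_apply 0) (measurable_firstObs 1)]
    rfl
  rw [e, e]
  exact h.map (measurable_pi_apply 0)

theorem llr_map_firstObs [IsProbabilityMeasure P₀] [IsProbabilityMeasure P₁] (h₀ : IIDLaw P₀)
    (h₁ : IIDLaw P₁) (h₀₁ : P₀.map (firstObs 1) ≪ P₁.map (firstObs 1))
    (h₁₀ : P₁.map (firstObs 1) ≪ P₀.map (firstObs 1)) (n : ℕ) :
    llr (P₁.map (firstObs n)) (P₀.map (firstObs n)) =ᵐ[P₀.map (firstObs n)]
      fun y => ∑ i, stepLLR P₀ P₁ (y i) := by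
  have hp₀ : IsProbabilityMeasure (P₀.map fun x => x 0) :=
    Measure.isProbabilityMeasure_map (measurable_pi_apply 0).aemeasurable
  have hp₁ : IsProbabilityMeasure (P₁.map fun x => x 0) :=
    Measure.isProbabilityMeasure_map (measurable_pi_apply 0).aemeasurable
  rw [h₀.map_firstObs, h₁.map_firstObs]
  exact llr_pi (map_zero_ac h₁₀) (map_zero_ac h₀₁)

theorem streamLLR_eq_sum [IsProbabilityMeasure P₀] [IsProbabilityMeasure P₁] (h₀ : IIDLaw P₀)
    (h₁ : IIDLaw P₁) (h₀₁ : P₀.map (firstObs 1) ≪ P₁.map (firstObs 1))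
    (h₁₀ : P₁.map (firstObs 1) ≪ P₀.map (firstObs 1)) (n : ℕ) {Q : Measure (ℕ → E)}
    (hQ : Q.map (firstObs n) ≪ P₀.map (firstObs n)) :
    ∀ᵐ x ∂Q, streamLLR P₀ P₁ n x = ∑ i ∈ Finset.range n, stepLLR P₀ P₁ (x i) := by
  filter_upwards [ae_of_ae_map (measurable_firstObs n).aemeasurable
    (hQ.ae_le (llr_map_firstObs h₀ h₁ h₀₁ h₁₀ n))] with x hx
  rw [streamLLR, hx, Finset.sum_range]
  rfl

end Stream

namespace StreamModel

variable {J : ℕ} (M : StreamModel.{u} J)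

/-- The log-likelihood ratio of one observation of the stream `j`. -/
noncomputable def step (j : Fin J) : M.E j → ℝ := stepLLR (M.P₀ j) (M.P₁ j)

@[fun_prop]
theorem measurable_step (j : Fin J) : Measurable (M.step j) := measurable_stepLLR

variable {M}

theorem IsIID.law (h : M.IsIID) (A : Finset (Fin J)) (j : Fin J) : IIDLaw (M.law A j) := by
  unfold StreamModel.law; split_ifs
  exacts [(h j).2, (h j).1]

theorem IsIID.streamLLR_eq_sum (h : M.IsIID) (A : Finset (Fin J)) (j : Fin J) (n : ℕ) :
    ∀ᵐ x ∂(M.law A j), streamLLR (M.P₀ j) (M.P₁ j) n x =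
      ∑ i ∈ Finset.range n, M.step j (x i) := by
  refine SeqTest.streamLLR_eq_sum (h j).1 (h j).2 (M.ac₀₁ j 1) (M.ac₁₀ j 1) n ?_
  unfold StreamModel.law; split_ifs
  exacts [M.ac₁₀ j n, Measure.AbsolutelyContinuous.rfl]

theorem IsIID.streamLLR_one (h : M.IsIID) (A : Finset (Fin J)) (j : Fin J) :
    streamLLR (M.P₀ j) (M.P₁ j) 1 =ᵐ[M.law A j] fun x => M.step j (x 0) := by
  filter_upwards [h.streamLLR_eq_sum A j 1] with x hx
  simpa using hx

theorem IsIID.Λ_eq_sum (h : M.IsIID) (A : Finset (Fin J)) :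
    ∀ᵐ ω ∂(M.P A), ∀ n j, M.Λ n ω j = ∑ i ∈ Finset.range n, M.step j (ω j i) := by
  rw [ae_all_iff]; intro n
  rw [ae_all_iff]; intro j
  exact (M.measurePreserving_eval_P A j).quasiMeasurePreserving.ae (h.streamLLR_eq_sum A j n)

theorem IsIID.iIndepFun_obs (h : M.IsIID) (A : Finset (Fin J)) :
    iIndepFun (fun (p : (_ : Fin J) × ℕ) (ω : M.Ω) => ω p.1 p.2) (M.P A) := by
  refine iIndepFun_uncurry (X := fun (j : Fin J) (i : ℕ) (ω : M.Ω) => ω j i)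
    (fun j i => by fun_prop) ?_ fun j => ?_
  · exact iIndepFun_pi (μ := M.law A) (X := fun j x => x) fun j => aemeasurable_id
  · have h1 := (h.law A j).1
    rw [iIndepFun_iff_map_fun_eq_infinitePi_map (by fun_prop)] at h1 ⊢
    have hm := (M.measurePreserving_eval_P A j).map_eq
    have e1 : (M.P A).map (fun ω i => ω j i) = (M.law A j).map fun x i => x i := by
      rw [← hm, Measure.map_map (by fun_prop) (by fun_prop)]; rfl
    have e2 : ∀ i : ℕ, (M.P A).map (fun ω => ω j i) = (M.law A j).map fun x => x i := fun i => by
      rw [← hm, Measure.map_map (by fun_prop) (by fun_prop)]; rfl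
    rw [e1, h1]
    congr 1
    funext i
    exact (e2 i).symm

variable (M)

/-- The σ-algebra generated by the observations after time `n`. -/
@[reducible] def future (n : ℕ) : MeasurableSpace M.Ω :=
  MeasurableSpace.comap (fun (ω : M.Ω) (j : Fin J) (i : ℕ) => ω j (n + i)) inferInstance

theorem future_le (n : ℕ) : M.future n ≤ (inferInstance : MeasurableSpace M.Ω) :=
  Measurable.comap_le (by fun_prop)

theorem measurable_obs_future (n i : ℕ) (j : Fin J) :
    Measurable[M.future n] fun ω : M.Ω => ω j (n + i) :=
  Measurable.comp (g := fun y : M.Ω => y j i) (by fun_prop) (comap_measurable _)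

theorem measurable_obs_σ {n i : ℕ} (hi : i < n) (j : Fin J) :
    Measurable[M.σ n] fun ω : M.Ω => ω j i :=
  Measurable.comp (g := fun y : ∀ j, Fin n → M.E j => y j ⟨i, hi⟩) (by fun_prop)
    (comap_measurable fun (ω : M.Ω) (j : Fin J) => firstObs n (ω j))

variable {M}

theorem IsIID.indep_future (h : M.IsIID) (A : Finset (Fin J)) (n : ℕ) :
    Indep (M.σ n) (M.future n) (M.P A) := by
  have hi := h.iIndepFun_obs A
  have hd : Disjoint {p : (_ : Fin J) × ℕ | p.2 < n} {p | n ≤ p.2} :=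
    Set.disjoint_left.2 fun p (h1 : p.2 < n) (h2 : n ≤ p.2) => absurd h1 (not_lt.2 h2)
  have hle : ∀ p : (_ : Fin J) × ℕ, MeasurableSpace.comap (fun ω : M.Ω => ω p.1 p.2) (M.mE p.1) ≤
      MeasurableSpace.pi := fun p => Measurable.comap_le (by fun_prop)
  have key := indep_iSup_of_disjoint hle hi.iIndep hd
  refine indep_of_indep_of_le_left (indep_of_indep_of_le_right key ?_) ?_
  · simp only [future, MeasurableSpace.pi, MeasurableSpace.comap_iSup, MeasurableSpace.comap_comp]
    refine iSup_le fun j => iSup_le fun i => ?_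
    refine le_iSup₂_of_le (⟨j, n + i⟩ : (_ : Fin J) × ℕ) ?_ le_rfl
    exact Nat.le_add_right n i
  · change MeasurableSpace.comap (fun (ω : M.Ω) (j : Fin J) => firstObs n (ω j)) _ ≤ _
    simp only [MeasurableSpace.pi, MeasurableSpace.comap_iSup, MeasurableSpace.comap_comp]
    refine iSup_le fun j => iSup_le fun i => ?_
    refine le_iSup₂_of_le (⟨j, i⟩ : (_ : Fin J) × ℕ) ?_ le_rfl
    exact i.2

/-- The mean of one log-likelihood ratio of the stream `j` when `A` is the set of signals. -/
noncomputable def drift (M : StreamModel.{u} J) (A : Finset (Fin J)) (j : Fin J) : ℝ :=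
  ∫ x, M.step j (x 0) ∂(M.law A j)

theorem IsIID.drift_eq_integral (h : M.IsIID) (A : Finset (Fin J)) (j : Fin J) :
    M.drift A j = ∫ x, streamLLR (M.P₀ j) (M.P₁ j) 1 x ∂(M.law A j) :=
  integral_congr_ae (h.streamLLR_one A j).symm

theorem IsIID.drift_of_mem (h : M.IsIID) {A : Finset (Fin J)} {j : Fin J} (hj : j ∈ A) :
    M.drift A j = M.I₁ j := by
  rw [h.drift_eq_integral]; simp [StreamModel.law, hj, I₁]

theorem IsIID.drift_of_notMem (h : M.IsIID) {A : Finset (Fin J)} {j : Fin J} (hj : j ∉ A) :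
    M.drift A j = -M.I₀ j := by
  rw [h.drift_eq_integral]; simp [StreamModel.law, hj, I₀, integral_neg]

theorem IsIID.integrable_step (h : M.IsIID) (hf : M.FiniteInformation) (A : Finset (Fin J))
    (j : Fin J) : Integrable (fun x : ℕ → M.E j => M.step j (x 0)) (M.law A j) := by
  rw [← integrable_congr (h.streamLLR_one A j)]
  unfold StreamModel.law; split_ifs
  exacts [(hf j).2, (hf j).1]

theorem IsIID.identDistrib_step (h : M.IsIID) (A : Finset (Fin J)) (j : Fin J) (i : ℕ) :
    IdentDistrib (fun x : ℕ → M.E j => M.step j (x i)) (fun x => M.step j (x 0))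
      (M.law A j) (M.law A j) :=
  ((h.law A j).2 i).comp (M.measurable_step j)

theorem IsIID.indepFun_step (h : M.IsIID) (A : Finset (Fin J)) (j : Fin J) :
    iIndepFun (fun (i : ℕ) (x : ℕ → M.E j) => M.step j (x i)) (M.law A j) :=
  (h.law A j).1.comp (fun _ => M.step j) fun _ => M.measurable_step j

theorem IsIID.integrable_obs (h : M.IsIID) (hf : M.FiniteInformation) (A : Finset (Fin J))
    (j : Fin J) (i : ℕ) : Integrable (fun ω : M.Ω => M.step j (ω j i)) (M.P A) :=
  (M.measurePreserving_eval_P A j).integrable_comp_of_integrable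
    (g := fun x : ℕ → M.E j => M.step j (x i)) ((h.identDistrib_step A j i).symm.integrable_snd
      (h.integrable_step hf A j))

theorem integral_comp_eval (M : StreamModel.{u} J) (A : Finset (Fin J)) (j : Fin J)
    {g : (ℕ → M.E j) → ℝ} (hg : Measurable g) :
    ∫ ω, g (ω j) ∂(M.P A) = ∫ x, g x ∂(M.law A j) := by
  have h := M.measurePreserving_eval_P A j
  rw [← h.map_eq, integral_map h.measurable.aemeasurable hg.aestronglyMeasurable]

theorem IsIID.integral_obs (h : M.IsIID) (A : Finset (Fin J)) (j : Fin J) (i : ℕ) :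
    ∫ ω, M.step j (ω j i) ∂(M.P A) = M.drift A j := by
  have hg : Measurable fun x : ℕ → M.E j => M.step j (x i) := by fun_prop
  rw [drift, ← (h.identDistrib_step A j i).integral_eq, ← M.integral_comp_eval A j hg]

end StreamModel

end SeqTest

namespace SeqTest

/-- Let `Z 0, Z 1, …` have the common mean `ν > 0` and be bounded above by `b`, and let `Z l` be
uncorrelated with the event that the partial sums stay below `c` up to time `l`.  Then the first
passage time over `c` has mean at most `(c + b) / ν`. -/
theorem sum_measureReal_le_of_first_passage {Ω : Type*} [MeasurableSpace Ω] {μ : Measure Ω}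
    [IsProbabilityMeasure μ] {Z : ℕ → Ω → ℝ} {b c ν : ℝ} (hb : 0 ≤ b) (hc : 0 < c) (hν : 0 < ν)
    (hZb : ∀ l ω, Z l ω ≤ b) (hZ : ∀ l, Integrable (Z l) μ)
    (hB : ∀ l, MeasurableSet {ω | ∀ r ≤ l, ∑ s ∈ Finset.range r, Z s ω < c})
    (hind : ∀ l, ∫ ω in {ω | ∀ r ≤ l, ∑ s ∈ Finset.range r, Z s ω < c}, Z l ω ∂μ =
      μ.real {ω | ∀ r ≤ l, ∑ s ∈ Finset.range r, Z s ω < c} * ν) (n : ℕ) :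
    ∑ l ∈ Finset.range n, μ.real {ω | ∀ r ≤ l, ∑ s ∈ Finset.range r, Z s ω < c} ≤
      (c + b) / ν := by
  set B : ℕ → Set Ω := fun l => {ω | ∀ r ≤ l, ∑ s ∈ Finset.range r, Z s ω < c} with hBdef
  have hanti : ∀ k l, k ≤ l → B l ⊆ B k := fun k l hkl ω hω r hr => hω r (hr.trans hkl)
  have key : ∀ n ω, ∑ l ∈ Finset.range n, (B l).indicator (Z l) ω ≤ c + b := by
    intro n ω
    induction n with
    | zero => simp; linarith
    | succ n ih =>
      rw [Finset.sum_range_succ]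
      by_cases hω : ω ∈ B n
      · have : ∑ l ∈ Finset.range n, (B l).indicator (Z l) ω = ∑ l ∈ Finset.range n, Z l ω :=
          Finset.sum_congr rfl fun l hl =>
            Set.indicator_of_mem (hanti l n (Finset.mem_range.1 hl).le hω) _
        rw [this, Set.indicator_of_mem hω]
        linarith [hω n le_rfl, hZb n ω]
      · rw [Set.indicator_of_notMem hω]; linarith
  rw [le_div_iff₀ hν, Finset.sum_mul]
  calc ∑ l ∈ Finset.range n, μ.real (B l) * ν
      = ∫ ω, ∑ l ∈ Finset.range n, (B l).indicator (Z l) ω ∂μ := by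
        rw [integral_finsetSum _ fun l _ => (hZ l).indicator (hB l)]
        refine Finset.sum_congr rfl fun l _ => ?_
        rw [integral_indicator (hB l), hind l]
    _ ≤ ∫ _, c + b ∂μ := integral_mono
        (integrable_finsetSum _ fun l _ => (hZ l).indicator (hB l)) (integrable_const _) (key n)
    _ = c + b := by simp

namespace StreamModel

variable {J : ℕ} {M : StreamModel.{u} J} {m : ℕ} {c : ℝ}

/-- Total mean absolute deviation of the log-likelihood ratios of `N` observations. -/
noncomputable def deviation (M : StreamModel.{u} J) (A : Finset (Fin J)) (N : ℕ) : ℝ :=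
  ∑ j, ∫ x, |∑ i ∈ Finset.range N, M.step j (x i) - N * M.drift A j| ∂(M.law A j)

/-- A lower bound of the increase, during the block `l` of `N` observations, of the difference
between the log-likelihood ratios of any signal and any noise stream. -/
noncomputable def blockGain (M : StreamModel.{u} J) (A : Finset (Fin J)) (N : ℕ) (η : ℝ) (l : ℕ)
    (ω : M.Ω) : ℝ :=
  N * η - ∑ j, |∑ i ∈ Finset.range N, M.step j (ω j (l * N + i)) - N * M.drift A j|

theorem sum_blockGain_le {A : Finset (Fin J)} {N : ℕ} {η : ℝ} {i j : Fin J} (hij : i ≠ j)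
    (hη : η ≤ M.drift A i - M.drift A j) (r : ℕ) (ω : M.Ω) :
    ∑ l ∈ Finset.range r, M.blockGain A N η l ω ≤
      ∑ k ∈ Finset.range (r * N), M.step i (ω i k) -
        ∑ k ∈ Finset.range (r * N), M.step j (ω j k) := by
  induction r with
  | zero => simp
  | succ r ih =>
    rw [Finset.sum_range_succ, add_mul, one_mul, Finset.sum_range_add, Finset.sum_range_add]
    set a := ∑ k ∈ Finset.range N, M.step i (ω i (r * N + k))
    set b := ∑ k ∈ Finset.range N, M.step j (ω j (r * N + k))
    have h1 : |a - N * M.drift A i| + |b - N * M.drift A j| ≤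
        ∑ j, |∑ i ∈ Finset.range N, M.step j (ω j (r * N + i)) - N * M.drift A j| := by
      rw [← Finset.sum_pair hij
        (f := fun j => |∑ i ∈ Finset.range N, M.step j (ω j (r * N + i)) - N * M.drift A j|)]
      exact Finset.sum_le_sum_of_subset_of_nonneg (Finset.subset_univ _)
        fun _ _ _ => abs_nonneg _
    have h2 := neg_abs_le (a - N * M.drift A i)
    have h3 := le_abs_self (b - N * M.drift A j)
    have h4 := mul_le_mul_of_nonneg_left hη (Nat.cast_nonneg (α := ℝ) N)
    unfold blockGain at ih ⊢
    linarith

theorem IsIID.integrable_abs_dev (h : M.IsIID) (hf : M.FiniteInformation) (A : Finset (Fin J))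
    (N s : ℕ) (j : Fin J) : Integrable (fun ω : M.Ω =>
      |∑ i ∈ Finset.range N, M.step j (ω j (s + i)) - N * M.drift A j|) (M.P A) :=
  ((integrable_finsetSum _ fun _ _ => h.integrable_obs hf A j _).sub (integrable_const _)).abs

theorem IsIID.integral_abs_dev (h : M.IsIID) (A : Finset (Fin J))
    (N s : ℕ) (j : Fin J) :
    ∫ ω, |∑ i ∈ Finset.range N, M.step j (ω j (s + i)) - N * M.drift A j| ∂(M.P A) =
      ∫ x, |∑ i ∈ Finset.range N, M.step j (x i) - N * M.drift A j| ∂(M.law A j) := by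
  have hg : Measurable fun x : ℕ → M.E j =>
      |∑ i ∈ Finset.range N, M.step j (x i) - N * M.drift A j| := by fun_prop
  have h1 := (((h.law A j).identDistrib_shift s).comp hg).integral_eq
  refine Eq.trans ?_ h1
  exact M.integral_comp_eval A j (g := fun x =>
    |∑ i ∈ Finset.range N, M.step j (x (s + i)) - N * M.drift A j|) (by fun_prop)

theorem IsIID.integral_blockGain (h : M.IsIID) (hf : M.FiniteInformation) (A : Finset (Fin J))
    (N : ℕ) (η : ℝ) (l : ℕ) :
    ∫ ω, M.blockGain A N η l ω ∂(M.P A) = N * η - M.deviation A N := by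
  unfold blockGain deviation
  rw [integral_sub (integrable_const _)
    (integrable_finsetSum _ fun j _ => h.integrable_abs_dev hf A N _ j),
    integral_finsetSum _ fun j _ => h.integrable_abs_dev hf A N _ j]
  simp only [h.integral_abs_dev, integral_const, probReal_univ, one_smul]

theorem measurable_blockGain_future (A : Finset (Fin J)) (N : ℕ) (η : ℝ) (l : ℕ) :
    Measurable[M.future (l * N)] (M.blockGain A N η l) := by
  have h : ∀ j i, Measurable[M.future (l * N)] fun ω : M.Ω => M.step j (ω j (l * N + i)) :=
    fun j i => (M.measurable_step j).comp (M.measurable_obs_future _ _ _)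
  unfold blockGain
  refine Measurable.sub measurable_const ?_
  refine Finset.measurable_sum _ fun j _ => Measurable.comp measurable_abs ?_
  exact (Finset.measurable_sum _ fun i _ => h j i).sub measurable_const

theorem measurable_blockGain_σ (A : Finset (Fin J)) (N : ℕ) (η : ℝ) {l r : ℕ} (hlr : l < r) :
    Measurable[M.σ (r * N)] (M.blockGain A N η l) := by
  have h : ∀ j, ∀ i ∈ Finset.range N,
      Measurable[M.σ (r * N)] fun ω : M.Ω => M.step j (ω j (l * N + i)) := by
    intro j i hi
    refine (M.measurable_step j).comp (M.measurable_obs_σ ?_ j)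
    have := Finset.mem_range.1 hi
    have := Nat.mul_le_mul_right N (show l + 1 ≤ r from hlr)
    linarith
  unfold blockGain
  refine Measurable.sub measurable_const ?_
  refine Finset.measurable_sum _ fun j _ => Measurable.comp measurable_abs ?_
  exact (Finset.measurable_sum _ fun i hi => h j i hi).sub measurable_const

theorem IsIID.expTime_gapT_le (h : M.IsIID) (hf : M.FiniteInformation) {A : Finset (Fin J)}
    (hA : A.card = m) (hm : 1 ≤ m) (hmJ : m ≤ J - 1) (hc : 0 < c) {N : ℕ} (hN : 1 ≤ N) {η : ℝ}
    (hη0 : 0 ≤ η) (hη : ∀ i ∈ A, ∀ j, j ∉ A → η ≤ M.drift A i - M.drift A j)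
    (hdev : M.deviation A N < N * η) :
    M.expTime A (M.gapT m c) ≤
      ENNReal.ofReal (N * ((c + N * η) / (N * η - M.deviation A N))) := by
  set Z := M.blockGain A N η with hZdef
  let B : ℕ → Set M.Ω := fun l => {ω | ∀ r ≤ l, ∑ s ∈ Finset.range r, Z s ω < c}
  have hBσ : ∀ l, MeasurableSet[M.σ (l * N)] (B l) := by
    intro l
    have : B l = ⋂ r ∈ Set.Iic l, {ω | ∑ s ∈ Finset.range r, Z s ω < c} := by
      ext ω; simp [B]
    rw [this]
    refine MeasurableSet.biInter (Set.to_countable _) fun r hr => ?_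
    have hs : Measurable[M.σ (l * N)] fun ω => ∑ s ∈ Finset.range r, Z s ω :=
      Finset.measurable_sum _ fun s hs =>
        measurable_blockGain_σ A N η ((Finset.mem_range.1 hs).trans_le hr)
    exact hs measurableSet_Iio
  have hB : ∀ l, MeasurableSet (B l) := fun l => M.σ.le _ _ (hBσ l)
  have hZint : ∀ l, Integrable (Z l) (M.P A) := fun l =>
    (integrable_const _).sub (integrable_finsetSum _ fun j _ => h.integrable_abs_dev hf A N _ j)
  have hsum := sum_measureReal_le_of_first_passage (μ := M.P A) (Z := Z) (b := N * η) (c := c)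
    (ν := N * η - M.deviation A N) (by positivity) hc (by linarith)
    (fun l ω => sub_le_self _ (Finset.sum_nonneg fun _ _ => abs_nonneg _)) hZint hB fun l => by
      rw [← h.integral_blockGain hf A N η l]
      exact (h.indep_future A (l * N)).setIntegral_eq (M.σ.le _) (M.future_le _) (hBσ l)
        (measurable_blockGain_future A N η l)
  have hpt : ∀ᵐ ω ∂(M.P A), ENat.toENNReal (M.gapT m c ω) ≤
      N * ∑' l, (B l).indicator (1 : M.Ω → ℝ≥0∞) ω := by
    filter_upwards [h.Λ_eq_sum A] with ω hω
    by_cases hall : ∀ l, ω ∈ B l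
    · have : ∑' l, (B l).indicator (1 : M.Ω → ℝ≥0∞) ω = ⊤ := by
        simp only [Set.indicator_of_mem (hall _), Pi.one_apply]
        exact ENNReal.tsum_const_eq_top_of_ne_zero one_ne_zero
      rw [this, ENNReal.mul_top (by exact_mod_cast (by omega : N ≠ 0))]
      exact le_top
    · classical
      push Not at hall
      set l := Nat.find hall with hl
      have hl1 : ω ∉ B l := Nat.find_spec hall
      have hl2 : ∀ k < l, ω ∈ B k := fun k hk => not_not.1 (Nat.find_min hall hk)
      have hlc : c ≤ ∑ s ∈ Finset.range l, Z s ω := by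
        by_contra hlt
        refine hl1 fun r hr => ?_
        rcases hr.lt_or_eq with hr | rfl
        · exact hl2 r hr r le_rfl
        · exact not_le.1 hlt
      have hl0 : 1 ≤ l := by
        by_contra h0
        have : l = 0 := by omega
        rw [this] at hlc
        simp at hlc
        linarith
      have hT : M.gapT m c ω ≤ ((l * N : ℕ) : WithTop ℕ) := by
        refine M.gapT_le_of_le_gap (Nat.mul_pos hl0 hN) ?_
        refine le_orderStat_sub hA hm hmJ hc fun i hi j hj => ?_
        rw [hω, hω]
        exact hlc.trans (sum_blockGain_le (fun e : i = j => hj (e ▸ hi)) (hη i hi j hj) l ω)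
      calc ENat.toENNReal (M.gapT m c ω) ≤ ENat.toENNReal ((l * N : ℕ) : ℕ∞) :=
            ENat.toENNReal_mono hT
        _ = N * (l : ℝ≥0∞) := by rw [ENat.toENNReal_coe]; push_cast; ring
        _ = N * ∑ k ∈ Finset.range l, (B k).indicator (1 : M.Ω → ℝ≥0∞) ω := by
            rw [Finset.sum_congr rfl fun k hk => Set.indicator_of_mem
              (hl2 k (Finset.mem_range.1 hk)) _]
            simp
        _ ≤ _ := by gcongr; exact ENNReal.sum_le_tsum _
  calc M.expTime A (M.gapT m c)
      ≤ ∫⁻ ω, N * ∑' l, (B l).indicator (1 : M.Ω → ℝ≥0∞) ω ∂(M.P A) := lintegral_mono_ae hpt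
    _ = N * ∑' l, M.P A (B l) := by
        rw [lintegral_const_mul _ (Measurable.tsum fun l =>
          measurable_one.indicator (hB l)), lintegral_tsum fun l =>
          (measurable_one.indicator (hB l)).aemeasurable]
        simp only [lintegral_indicator_one (hB _)]
    _ ≤ N * ENNReal.ofReal ((c + N * η) / (N * η - M.deviation A N)) := by
        gcongr
        refine ENNReal.tsum_le_of_sum_range_le fun n => ?_
        rw [← ENNReal.ofReal_toReal (a := ∑ l ∈ Finset.range n, M.P A (B l))
          (ENNReal.sum_ne_top.2 fun l _ => measure_ne_top _ _)]
        refine ENNReal.ofReal_le_ofReal ?_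
        rw [ENNReal.toReal_sum fun l _ => measure_ne_top _ _]
        exact hsum n
    _ = _ := by rw [ENNReal.ofReal_mul (Nat.cast_nonneg _), ENNReal.ofReal_natCast]

end StreamModel

end SeqTest

namespace SeqTest

namespace StreamModel

variable {J : ℕ} {M : StreamModel.{u} J} {A : Finset (Fin J)} {i j : Fin J}
  {T : M.Ω → WithTop ℕ}

/-- The sum over the times `k < min T n` of the differences between the one-observation
log-likelihood ratios of the streams `i` and `j`. -/
noncomputable def stoppedDiff (M : StreamModel.{u} J) (i j : Fin J) (T : M.Ω → WithTop ℕ) (n : ℕ)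
    (ω : M.Ω) : ℝ :=
  ∑ k ∈ Finset.range n, {ω | (k : WithTop ℕ) < T ω}.indicator
    (fun ω => M.step i (ω i k) - M.step j (ω j k)) ω

theorem stoppedDiff_of_eq {ω : M.Ω} {n k : ℕ} (hk : T ω = k) (hkn : k ≤ n) :
    M.stoppedDiff i j T n ω =
      ∑ l ∈ Finset.range k, M.step i (ω i l) - ∑ l ∈ Finset.range k, M.step j (ω j l) := by
  rw [stoppedDiff, ← Finset.sum_sdiff (Finset.range_mono hkn), Finset.sum_eq_zero, zero_add,
    ← Finset.sum_sub_distrib]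
  · refine Finset.sum_congr rfl fun l hl => Set.indicator_of_mem ?_ _
    rw [Set.mem_ofPred_eq, hk]
    exact_mod_cast Finset.mem_range.1 hl
  · intro l hl
    refine Set.indicator_of_notMem ?_ _
    rw [Finset.mem_sdiff, Finset.mem_range, Finset.mem_range] at hl
    rw [Set.mem_ofPred_eq, hk, not_lt]
    exact_mod_cast not_lt.1 hl.2

theorem stoppedDiff_of_lt {ω : M.Ω} {n : ℕ} (hn : (n : WithTop ℕ) < T ω) :
    M.stoppedDiff i j T n ω =
      ∑ l ∈ Finset.range n, M.step i (ω i l) - ∑ l ∈ Finset.range n, M.step j (ω j l) := by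
  rw [stoppedDiff, ← Finset.sum_sub_distrib]
  refine Finset.sum_congr rfl fun l hl => Set.indicator_of_mem ?_ _
  refine lt_trans ?_ hn
  exact_mod_cast Finset.mem_range.1 hl

theorem measurableSet_lt (hT : IsStoppingTime M.σ T) (k : ℕ) :
    MeasurableSet[M.σ k] {ω | (k : WithTop ℕ) < T ω} :=
  hT.measurableSet_gt k

theorem measurable_stoppedDiff (hT : IsStoppingTime M.σ T) (n : ℕ) :
    Measurable (M.stoppedDiff i j T n) := by
  unfold stoppedDiff
  refine Finset.measurable_sum _ fun k _ =>
    Measurable.indicator ?_ (M.σ.le k _ (measurableSet_lt hT k))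
  fun_prop

theorem IsIID.integrable_stoppedDiff (h : M.IsIID) (hf : M.FiniteInformation)
    (hT : IsStoppingTime M.σ T) (n : ℕ) : Integrable (M.stoppedDiff i j T n) (M.P A) :=
  integrable_finsetSum _ fun k _ =>
    ((h.integrable_obs hf A i k).sub (h.integrable_obs hf A j k)).indicator
      (M.σ.le k _ (measurableSet_lt hT k))

/-- Wald's identity at the bounded stopping time `min T n`. -/
theorem IsIID.integral_stoppedDiff (h : M.IsIID) (hf : M.FiniteInformation)
    (hT : IsStoppingTime M.σ T) (n : ℕ) :
    ∫ ω, M.stoppedDiff i j T n ω ∂(M.P A) =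
      (∑ k ∈ Finset.range n, (M.P A).real {ω | (k : WithTop ℕ) < T ω}) *
        (M.drift A i - M.drift A j) := by
  have hm : ∀ k : ℕ, MeasurableSet {ω : M.Ω | (k : WithTop ℕ) < T ω} := fun k =>
    M.σ.le k _ (measurableSet_lt hT k)
  have hi : ∀ k, Integrable (fun ω : M.Ω => M.step i (ω i k) - M.step j (ω j k)) (M.P A) :=
    fun k => (h.integrable_obs hf A i k).sub (h.integrable_obs hf A j k)
  unfold stoppedDiff
  rw [integral_finsetSum _ fun k _ => (hi k).indicator (hm k), Finset.sum_mul]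
  refine Finset.sum_congr rfl fun k _ => ?_
  have hfut : Measurable[M.future k] fun ω : M.Ω => M.step i (ω i k) - M.step j (ω j k) :=
    ((M.measurable_step i).comp (M.measurable_obs_future k 0 i)).sub
      ((M.measurable_step j).comp (M.measurable_obs_future k 0 j))
  rw [integral_indicator (hm k), (h.indep_future A k).setIntegral_eq (M.σ.le k) (M.future_le k)
    (measurableSet_lt hT k) hfut, integral_sub (h.integrable_obs hf A i k)
    (h.integrable_obs hf A j k), h.integral_obs, h.integral_obs]

theorem IsIID.setLIntegral_exp_sum (h : M.IsIID) (hi : i ∈ A) (hj : j ∉ A) {k : ℕ} {F : Set M.Ω}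
    (hF : MeasurableSet[M.σ k] F) {φ : M.Ω → ℝ} (hφ : ∀ ω ∈ F, φ ω =
      ∑ l ∈ Finset.range k, M.step i (ω i l) - ∑ l ∈ Finset.range k, M.step j (ω j l)) :
    ∫⁻ ω in F, ENNReal.ofReal (Real.exp (-φ ω)) ∂(M.P A) = M.P (insert j (A.erase i)) F := by
  rw [M.measure_swap_eq hi hj k hF]
  refine setLIntegral_congr_fun_ae (M.σ.le k _ hF) ?_
  filter_upwards [h.Λ_eq_sum A] with ω hω hωF
  rw [hφ ω hωF, hω, hω]

theorem setOf_le_eq_biUnion (F : Set M.Ω) (n : ℕ) : F ∩ {ω | T ω ≤ n} =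
    ⋃ k ∈ Finset.range (n + 1), F ∩ {ω | T ω = k} := by
  ext ω
  induction hω : T ω using WithTop.recTopCoe with
  | top => simp [hω]
  | coe a => simp [hω]

theorem IsIID.setLIntegral_exp_stoppedDiff (h : M.IsIID) (hi : i ∈ A) (hj : j ∉ A)
    (hT : IsStoppingTime M.σ T) {F : Set M.Ω} (hF : MeasurableSet[hT.measurableSpace] F) (n : ℕ) :
    ∫⁻ ω in F ∩ {ω | T ω ≤ n}, ENNReal.ofReal (Real.exp (-M.stoppedDiff i j T n ω)) ∂(M.P A) =
      M.P (insert j (A.erase i)) (F ∩ {ω | T ω ≤ n}) := by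
  have hFk : ∀ k : ℕ, MeasurableSet[M.σ k] (F ∩ {ω | T ω = k}) := by
    intro k
    have := (hF.2 k).inter (hT.measurableSet_eq k)
    refine (congrArg _ ?_).mp this
    ext ω
    simp only [Set.mem_inter_iff, Set.mem_ofPred_eq]
    exact ⟨fun hx => ⟨hx.1.1, hx.2⟩, fun hx => ⟨⟨hx.1, hx.2.le⟩, hx.2⟩⟩
  have hd : Set.PairwiseDisjoint (Finset.range (n + 1) : Set ℕ) fun k : ℕ =>
      F ∩ {ω : M.Ω | T ω = k} := by
    intro a _ b _ hab
    refine Set.disjoint_left.2 fun ω ha hb => hab ?_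
    have := ha.2.symm.trans hb.2
    exact_mod_cast this
  have hm : ∀ k ∈ Finset.range (n + 1), MeasurableSet (F ∩ {ω : M.Ω | T ω = k}) :=
    fun k _ => M.σ.le k _ (hFk k)
  rw [setOf_le_eq_biUnion, lintegral_biUnion_finset hd hm, measure_biUnion_finset hd hm]
  refine Finset.sum_congr rfl fun k hk => ?_
  exact h.setLIntegral_exp_sum hi hj (hFk k) fun ω hω =>
    stoppedDiff_of_eq hω.2 (Nat.lt_succ_iff.1 (Finset.mem_range.1 hk))

theorem IsIID.lintegral_exp_stoppedDiff (h : M.IsIID) (hi : i ∈ A) (hj : j ∉ A)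
    (hT : IsStoppingTime M.σ T) (n : ℕ) :
    ∫⁻ ω, ENNReal.ofReal (Real.exp (-M.stoppedDiff i j T n ω)) ∂(M.P A) = 1 := by
  have h1 := h.setLIntegral_exp_stoppedDiff hi hj hT
    (@MeasurableSet.univ _ hT.measurableSpace) n
  have h2 := h.setLIntegral_exp_sum hi hj (measurableSet_lt hT n) fun ω hω =>
    stoppedDiff_of_lt (i := i) (j := j) hω
  rw [Set.univ_inter] at h1
  have hm : MeasurableSet {ω : M.Ω | T ω ≤ n} := M.σ.le n _ (hT n)
  have hc : {ω : M.Ω | T ω ≤ n}ᶜ = {ω | (n : WithTop ℕ) < T ω} := by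
    ext ω; simp
  rw [← lintegral_add_compl _ hm, h1, hc, h2, ← hc, prob_add_prob_compl hm]

theorem IsIID.mul_measureReal_sub_le (h : M.IsIID) (hf : M.FiniteInformation) (hi : i ∈ A)
    (hj : j ∉ A) (hT : IsStoppingTime M.σ T) {F : Set M.Ω}
    (hF : MeasurableSet[hT.measurableSpace] F) (n : ℕ) (a : ℝ) :
    a * (M.P A).real (F ∩ {ω | T ω ≤ n}) -
        Real.exp a * (M.P (insert j (A.erase i))).real (F ∩ {ω | T ω ≤ n}) ≤
      (∑ k ∈ Finset.range n, (M.P A).real {ω | (k : WithTop ℕ) < T ω}) *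
        (M.drift A i - M.drift A j) := by
  rw [← h.integral_stoppedDiff hf hT n]
  set φ := M.stoppedDiff i j T n with hφ
  set G := F ∩ {ω | T ω ≤ n} with hG
  have hGm : MeasurableSet G := M.σ.le n _ (hF.2 n)
  have hφi : Integrable φ (M.P A) := h.integrable_stoppedDiff hf hT n
  have hWm : Measurable fun ω => Real.exp (-φ ω) :=
    Real.measurable_exp.comp (measurable_stoppedDiff hT n).neg
  have hW1 := h.lintegral_exp_stoppedDiff hi hj hT n
  have hWi : Integrable (fun ω => Real.exp (-φ ω)) (M.P A) := by
    refine ⟨hWm.aestronglyMeasurable, ?_⟩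
    rw [hasFiniteIntegral_iff_ofReal (Eventually.of_forall fun ω => Real.exp_nonneg _), hW1]
    exact ENNReal.one_lt_top
  have hWG : ∫ ω in G, Real.exp (-φ ω) ∂(M.P A) = (M.P (insert j (A.erase i))).real G := by
    rw [integral_eq_lintegral_of_nonneg_ae (Eventually.of_forall fun ω => Real.exp_nonneg _)
      hWm.aestronglyMeasurable, h.setLIntegral_exp_stoppedDiff hi hj hT hF n]
    rfl
  have hW : ∫ ω, Real.exp (-φ ω) ∂(M.P A) = 1 := by
    rw [integral_eq_lintegral_of_nonneg_ae (Eventually.of_forall fun ω => Real.exp_nonneg _)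
      hWm.aestronglyMeasurable, hW1, ENNReal.toReal_one]
  have hWc : ∫ ω in Gᶜ, Real.exp (-φ ω) ∂(M.P A) ≤ 1 :=
    hW ▸ setIntegral_le_integral hWi (Eventually.of_forall fun ω => Real.exp_nonneg _)
  rw [← integral_add_compl hGm hφi]
  have e1 : (a + 1) * (M.P A).real G - Real.exp a * (M.P (insert j (A.erase i))).real G ≤
      ∫ ω in G, φ ω ∂(M.P A) := by
    have : ∫ ω in G, ((a + 1) - Real.exp a * Real.exp (-φ ω)) ∂(M.P A) =
        (a + 1) * (M.P A).real G - Real.exp a * (M.P (insert j (A.erase i))).real G := by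
      rw [integral_sub (integrable_const _) (hWi.integrableOn.const_mul _), integral_const_mul,
        hWG, setIntegral_const, smul_eq_mul, mul_comm]
    rw [← this]
    refine integral_mono ((integrable_const _).sub (hWi.integrableOn.const_mul _))
      hφi.integrableOn fun ω => ?_
    have := Real.add_one_le_exp (a + -φ ω)
    rw [Real.exp_add] at this
    simp only
    linarith
  have e2 : (M.P A).real Gᶜ - 1 ≤ ∫ ω in Gᶜ, φ ω ∂(M.P A) := by
    have : ∫ ω in Gᶜ, (1 - Real.exp (-φ ω)) ∂(M.P A) =
        (M.P A).real Gᶜ - ∫ ω in Gᶜ, Real.exp (-φ ω) ∂(M.P A) := by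
      rw [integral_sub (integrable_const _) hWi.integrableOn, setIntegral_const, smul_eq_mul,
        mul_one]
    refine le_trans (by linarith) (this.symm.le.trans ?_)
    refine integral_mono ((integrable_const _).sub hWi.integrableOn)
      hφi.integrableOn fun ω => ?_
    have := Real.add_one_le_exp (-φ ω)
    simp only
    linarith
  have e3 : (M.P A).real Gᶜ = 1 - (M.P A).real G := probReal_compl_eq_one_sub hGm
  linarith

theorem sum_measure_lt_le_expTime (hT : IsStoppingTime M.σ T) (A : Finset (Fin J)) (n : ℕ) :
    ∑ k ∈ Finset.range n, M.P A {ω | (k : WithTop ℕ) < T ω} ≤ M.expTime A T := by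
  have hm : ∀ k : ℕ, MeasurableSet {ω : M.Ω | (k : WithTop ℕ) < T ω} := fun k =>
    M.σ.le k _ (measurableSet_lt hT k)
  calc _ = ∫⁻ ω, ∑ k ∈ Finset.range n,
        {ω | (k : WithTop ℕ) < T ω}.indicator (1 : M.Ω → ℝ≥0∞) ω ∂(M.P A) := by
        rw [lintegral_finsetSum _ fun k _ => measurable_one.indicator (hm k)]
        simp only [lintegral_indicator_one (hm _)]
    _ ≤ _ := by
        refine lintegral_mono fun ω => ?_
        induction hω : T ω using WithTop.recTopCoe with
        | top => exact le_top
        | coe t =>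
          simp only [Set.indicator_apply, Set.mem_ofPred_eq, hω, Pi.one_apply, Finset.sum_boole]
          change _ ≤ ENat.toENNReal (t : ℕ∞)
          rw [ENat.toENNReal_coe, Nat.cast_le]
          calc _ ≤ (Finset.range t).card := Finset.card_le_card fun k hk => by
                have := (Finset.mem_filter.1 hk).2
                exact Finset.mem_range.2 (WithTop.coe_lt_coe.1 this)
            _ = t := Finset.card_range t

/-- Lower bound for the mean of a stopping time whose observations separate the signal sets `A`
and `A \ {i} ∪ {j}` through an event `F`. -/
theorem IsIID.le_expTime (h : M.IsIID) (hf : M.FiniteInformation) (hi : i ∈ A)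
    (hj : j ∉ A) (hT : IsStoppingTime M.σ T) (hTA : ∀ᵐ ω ∂(M.P A), T ω ≠ ⊤) {F : Set M.Ω}
    (hF : MeasurableSet[hT.measurableSpace] F) {a : ℝ}
    (ha : Real.exp a * (M.P (insert j (A.erase i))).real F ≤ 1)
    (hη : 0 < M.drift A i - M.drift A j) :
    ENNReal.ofReal ((a * (M.P A).real F - 1) / (M.drift A i - M.drift A j)) ≤
      M.expTime A T := by
  by_cases htop : M.expTime A T = ⊤
  · rw [htop]; exact le_top
  rw [← ENNReal.ofReal_toReal htop]
  refine ENNReal.ofReal_le_ofReal ?_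
  rw [div_le_iff₀ hη]
  have hle : ∀ n : ℕ, a * (M.P A).real (F ∩ {ω | T ω ≤ n}) - 1 ≤
      (M.expTime A T).toReal * (M.drift A i - M.drift A j) := by
    intro n
    have h1 := h.mul_measureReal_sub_le hf hi hj hT hF n a
    have h2 : Real.exp a * (M.P (insert j (A.erase i))).real (F ∩ {ω | T ω ≤ n}) ≤ 1 :=
      le_trans (mul_le_mul_of_nonneg_left (measureReal_mono Set.inter_subset_left)
        (Real.exp_nonneg _)) ha
    have h3 : ∑ k ∈ Finset.range n, (M.P A).real {ω | (k : WithTop ℕ) < T ω} ≤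
        (M.expTime A T).toReal := by
      simp only [measureReal_def]
      rw [← ENNReal.toReal_sum fun k _ => measure_ne_top _ _]
      exact ENNReal.toReal_mono htop (sum_measure_lt_le_expTime hT A n)
    have h4 := mul_le_mul_of_nonneg_right h3 hη.le
    linarith
  have hmono : Monotone fun n : ℕ => F ∩ {ω | T ω ≤ n} := fun a b hab =>
    Set.inter_subset_inter_right _ fun ω (hω : T ω ≤ a) => hω.trans (by exact_mod_cast hab)
  have hlim : Tendsto (fun n : ℕ => (M.P A).real (F ∩ {ω | T ω ≤ n})) atTop
      (𝓝 ((M.P A).real F)) := by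
    have h1 := tendsto_measure_iUnion_atTop (μ := M.P A) hmono
    have h2 : M.P A (⋃ n : ℕ, F ∩ {ω | T ω ≤ n}) = M.P A F := by
      refine measure_congr ?_
      filter_upwards [hTA] with ω hω
      obtain ⟨t, ht⟩ := WithTop.ne_top_iff_exists.1 hω
      refine propext ⟨fun hx => ?_, fun hx => ?_⟩
      · obtain ⟨n, hn⟩ := Set.mem_iUnion.1 hx
        exact hn.1
      · exact Set.mem_iUnion.2 ⟨t, hx, ht.symm.le⟩
    rw [h2] at h1
    exact (ENNReal.tendsto_toReal (measure_ne_top _ _)).comp h1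
  exact le_of_tendsto ((hlim.const_mul a).sub_const 1) (Eventually.of_forall hle)

end StreamModel

end SeqTest

theorem ProbabilityTheory.mul_measureReal_le_integral_cond {Ω : Type*} [MeasurableSpace Ω]
    {μ : Measure Ω} [IsProbabilityMeasure μ] {E F : Set Ω}
    (hF : MeasurableSet F) (hFE : F ⊆ E) (hE0 : μ E ≠ 0) {g : Ω → ℝ} (hg : Integrable g μ)
    (hg0 : ∀ ω, 0 ≤ g ω) {κ : ℝ} (hκ : ∀ ω ∈ F, κ ≤ g ω) :
    κ * μ.real F ≤ ∫ ω, g ω ∂(cond μ E) := by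
  rw [cond, integral_smul_measure]
  have h0 : 0 ≤ ∫ ω in E, g ω ∂μ := integral_nonneg fun ω => hg0 ω
  have h1 : 1 ≤ ((μ E)⁻¹).toReal := by
    rw [ENNReal.toReal_inv, one_le_inv₀ (ENNReal.toReal_pos hE0 (measure_ne_top _ _))]
    exact measureReal_le_one
  have h2 : κ * μ.real F ≤ ∫ ω in E, g ω ∂μ := by
    rw [mul_comm, ← smul_eq_mul, ← setIntegral_const]
    refine (setIntegral_mono_on (integrable_const _).integrableOn hg.integrableOn hF hκ).trans ?_
    exact setIntegral_mono_set hg.integrableOn (Eventually.of_forall fun ω => hg0 ω)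
      (Eventually.of_forall hFE)
  rw [smul_eq_mul]
  nlinarith

namespace SeqTest

namespace StreamModel

variable {J : ℕ} {M : StreamModel.{u} J} {m : ℕ} {α β : ℝ}

theorem IsTest.integrable {p : M.Rule} (h : M.IsTest p) (A : Finset (Fin J))
    (g : Finset (Fin J) → ℝ) : Integrable (fun ω => g (p.2 ω)) (M.P A) := by
  refine Integrable.of_bound (h.measurable g).aestronglyMeasurable (∑ D, ‖g D‖)
    (Eventually.of_forall fun ω => ?_)
  exact Finset.single_le_sum (f := fun D => ‖g D‖) (fun D _ => norm_nonneg _) (Finset.mem_univ _)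

theorem IsTest.measurableSet {p : M.Rule} (h : M.IsTest p) (q : Finset (Fin J) → Prop) :
    MeasurableSet {ω | q (p.2 ω)} :=
  measurableSet_setOfPred.2 (h.measurable q)

theorem inv_le_card_div {D S : Finset (Fin J)} (hS : S ⊆ D) {j : Fin J} (hj : j ∈ S) :
    (J : ℝ)⁻¹ ≤ (S.card : ℝ) / (D.card : ℝ) := by
  have h1 : 1 ≤ S.card := Finset.card_pos.2 ⟨j, hj⟩
  have h2 : 1 ≤ D.card := Finset.card_pos.2 ⟨j, hS hj⟩
  have h3 : D.card ≤ J := by simpa using Finset.card_le_univ D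
  have h1' : (1 : ℝ) ≤ S.card := by exact_mod_cast h1
  have h2' : (0 : ℝ) < D.card := by exact_mod_cast h2
  have h3' : (D.card : ℝ) ≤ J := by exact_mod_cast h3
  rw [inv_eq_one_div]
  exact div_le_div₀ (by linarith) h1' h2' h3'

theorem measureReal_mem_le {S : Set (Finset (Fin J))} {p : M.Rule} (hp : p ∈ M.control S α β)
    {A : Finset (Fin J)} (hA : A ∈ S) {j : Fin J} (hj : j ∉ A) :
    (M.P A).real {ω | j ∈ p.2 ω} ≤ J * α := by
  obtain ⟨hT, hp⟩ := hp
  obtain ⟨-, h0, h1, -, -⟩ := hp A hA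
  have hJ : (0 : ℝ) < J := by exact_mod_cast (Fin.pos j)
  have h := mul_measureReal_le_integral_cond (μ := M.P A) (κ := (J : ℝ)⁻¹)
    (hT.measurableSet_mem j)
    (fun ω (hω : j ∈ p.2 ω) => Finset.card_pos.2 ⟨j, hω⟩) h0
    (hT.integrable A fun D => ((D \ A).card : ℝ) / (D.card : ℝ)) (fun ω => by positivity)
    fun ω (hω : j ∈ p.2 ω) =>
      inv_le_card_div Finset.sdiff_subset (Finset.mem_sdiff.2 ⟨hω, hj⟩)
  exact (inv_mul_le_iff₀ hJ).1 (h.trans h1)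

theorem measureReal_notMem_le {S : Set (Finset (Fin J))} {p : M.Rule} (hp : p ∈ M.control S α β)
    {A : Finset (Fin J)} (hA : A ∈ S) {j : Fin J} (hj : j ∈ A) :
    (M.P A).real {ω | j ∉ p.2 ω} ≤ J * β := by
  obtain ⟨hT, hp⟩ := hp
  obtain ⟨-, -, -, h0, h1⟩ := hp A hA
  have hJ : (0 : ℝ) < J := by exact_mod_cast (Fin.pos j)
  have h := mul_measureReal_le_integral_cond (μ := M.P A) (κ := (J : ℝ)⁻¹)
    (hT.measurableSet fun D => j ∉ D)
    (fun ω (hω : j ∉ p.2 ω) => Finset.card_pos.2 ⟨j, Finset.mem_compl.2 hω⟩) h0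
    (hT.integrable A fun D => ((A \ D).card : ℝ) / (Dᶜ.card : ℝ)) (fun ω => by positivity)
    fun ω (hω : j ∉ p.2 ω) => inv_le_card_div
      (fun k hk => Finset.mem_compl.2 (Finset.mem_sdiff.1 hk).2) (Finset.mem_sdiff.2 ⟨hj, hω⟩)
  exact (inv_mul_le_iff₀ hJ).1 (h.trans h1)

theorem card_swap {A : Finset (Fin J)} {i j : Fin J} (hi : i ∈ A) (hj : j ∉ A) :
    (insert j (A.erase i)).card = A.card := by
  rw [Finset.card_insert_of_notMem fun h => hj (Finset.mem_of_mem_erase h),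
    Finset.card_erase_add_one hi]

theorem exists_I₁_eq_η₁ {A : Finset (Fin J)} (hA : A.Nonempty) : ∃ i ∈ A, M.I₁ i = M.η₁ A := by
  have : Nonempty {j // j ∈ A} := hA.coe_sort
  obtain ⟨i, hi⟩ := exists_eq_ciInf_of_finite (f := fun j : {j // j ∈ A} => M.I₁ j)
  exact ⟨i, i.2, hi⟩

theorem exists_I₀_eq_η₀ {A : Finset (Fin J)} (hA : ∃ j, j ∉ A) : ∃ j, j ∉ A ∧ M.I₀ j = M.η₀ A := by
  have : Nonempty {j // j ∉ A} := by obtain ⟨j, hj⟩ := hA; exact ⟨⟨j, hj⟩⟩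
  obtain ⟨i, hi⟩ := exists_eq_ciInf_of_finite (f := fun j : {j // j ∉ A} => M.I₀ j)
  exact ⟨i, i.2, hi⟩

theorem η₁_le {A : Finset (Fin J)} {i : Fin J} (hi : i ∈ A) : M.η₁ A ≤ M.I₁ i :=
  ciInf_le (f := fun j : {j // j ∈ A} => M.I₁ j) (Set.finite_range _).bddBelow ⟨i, hi⟩

theorem η₀_le {A : Finset (Fin J)} {j : Fin J} (hj : j ∉ A) : M.η₀ A ≤ M.I₀ j :=
  ciInf_le (f := fun j : {j // j ∉ A} => M.I₀ j) (Set.finite_range _).bddBelow ⟨j, hj⟩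

theorem IsIID.le_drift_sub (h : M.IsIID) {A : Finset (Fin J)} {i j : Fin J} (hi : i ∈ A)
    (hj : j ∉ A) : M.η₁ A + M.η₀ A ≤ M.drift A i - M.drift A j := by
  rw [h.drift_of_mem hi, h.drift_of_notMem hj]
  linarith [M.η₁_le hi, M.η₀_le hj]

theorem IsIID.exists_drift_sub_eq (h : M.IsIID) {A : Finset (Fin J)} (hA : A.card = m)
    (hm : 1 ≤ m) (hmJ : m ≤ J - 1) :
    ∃ i ∈ A, ∃ j, j ∉ A ∧ M.drift A i - M.drift A j = M.η₁ A + M.η₀ A := by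
  obtain ⟨i, hi, hi'⟩ := M.exists_I₁_eq_η₁ (A := A) (Finset.card_pos.1 (by omega))
  have hne : ∃ j, j ∉ A := by
    by_contra hc
    push Not at hc
    have : A = Finset.univ := Finset.eq_univ_of_forall hc
    rw [this, Finset.card_univ, Fintype.card_fin] at hA
    omega
  obtain ⟨j, hj, hj'⟩ := M.exists_I₀_eq_η₀ hne
  refine ⟨i, hi, j, hj, ?_⟩
  rw [h.drift_of_mem hi, h.drift_of_notMem hj, hi', hj']
  ring

theorem η₁_add_η₀_pos {A : Finset (Fin J)} (hpos : ∀ j, 0 < M.I₀ j ∧ 0 < M.I₁ j)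
    (h : M.IsIID) (hA : A.card = m) (hm : 1 ≤ m) (hmJ : m ≤ J - 1) : 0 < M.η₁ A + M.η₀ A := by
  obtain ⟨i, hi, j, hj, he⟩ := h.exists_drift_sub_eq hA hm hmJ
  rw [← he, h.drift_of_mem hi, h.drift_of_notMem hj]
  linarith [(hpos i).2, (hpos j).1]

theorem abs_log_min (hα : α ∈ Set.Ioo (0 : ℝ) 1) (hβ : β ∈ Set.Ioo (0 : ℝ) 1) :
    |Real.log (min α β)| = -Real.log (min α β) :=
  abs_of_neg (Real.log_neg (lt_min hα.1 hβ.1) ((min_le_left _ _).trans_lt hα.2))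

/-- Every test that controls the two error rates satisfies the information lower bound. -/
theorem IsIID.le_optTime (h : M.IsIID) (hf : M.FiniteInformation) {A : Finset (Fin J)}
    (hA : A.card = m) (hm : 1 ≤ m) (hmJ : m ≤ J - 1) (hη : 0 < M.η₁ A + M.η₀ A)
    (hα : α ∈ Set.Ioo (0 : ℝ) 1) (hβ : β ∈ Set.Ioo (0 : ℝ) 1)
    (hJ : Real.log J ≤ |Real.log (min α β)|) :
    ENNReal.ofReal (((|Real.log (min α β)| - Real.log J) * (1 - J * max α β) - 1) /
      (M.η₁ A + M.η₀ A)) ≤ M.optTime m A α β := by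
  obtain ⟨i, hi, j, hj, he⟩ := h.exists_drift_sub_eq hA hm hmJ
  have hij : i ≠ j := fun e => hj (e ▸ hi)
  have hB : insert j (A.erase i) ∈ signalClass J m := (card_swap hi hj).trans hA
  have hJ0 : (0 : ℝ) < J := by exact_mod_cast (by omega : 0 < J)
  have hmin : 0 < min α β := lt_min hα.1 hβ.1
  set a := |Real.log (min α β)| - Real.log J with ha
  have ha0 : 0 ≤ a := by linarith
  have hexp : Real.exp a * (J * min α β) = 1 := by
    rw [ha, abs_log_min hα hβ, sub_eq_add_neg, Real.exp_add, Real.exp_neg, Real.exp_neg,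
      Real.exp_log hmin, Real.exp_log hJ0]
    field_simp
  refine le_iInf₂ fun p hp => ?_
  obtain ⟨hT, hD⟩ := hp.1
  have main : ∀ F : Set M.Ω, MeasurableSet[hT.measurableSpace] F →
      (M.P (insert j (A.erase i))).real F ≤ J * min α β →
      1 - J * max α β ≤ (M.P A).real F →
      ENNReal.ofReal ((a * (1 - J * max α β) - 1) / (M.η₁ A + M.η₀ A)) ≤ M.expTime A p.1 := by
    intro F hF h1 h2
    refine le_trans (ENNReal.ofReal_le_ofReal ?_) (h.le_expTime hf hi hj hT (hp.2 A hA).1 hF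
      (a := a) ((mul_le_mul_of_nonneg_left h1 (Real.exp_nonneg _)).trans hexp.le) (he ▸ hη))
    rw [he]
    exact div_le_div_of_nonneg_right
      (sub_le_sub_right (mul_le_mul_of_nonneg_left h2 ha0) _) hη.le
  rcases le_total α β with hαβ | hαβ
  · refine main {ω | i ∈ p.2 ω} (hD i) ?_ ?_
    · rw [min_eq_left hαβ]
      exact measureReal_mem_le hp hB (by simp [hij])
    · have h1 := measureReal_notMem_le hp hA hi
      have h2 : (M.P A).real {ω | i ∈ p.2 ω}ᶜ = 1 - (M.P A).real {ω | i ∈ p.2 ω} :=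
        probReal_compl_eq_one_sub (hp.1.measurableSet_mem i)
      change (M.P A).real {ω | i ∈ p.2 ω}ᶜ ≤ _ at h1
      rw [max_eq_right hαβ]
      linarith
  · refine main {ω | j ∈ p.2 ω}ᶜ (hD j).compl ?_ ?_
    · rw [min_eq_right hαβ]
      exact measureReal_notMem_le hp hB (by simp)
    · have h1 := measureReal_mem_le hp hA hj
      have h2 : (M.P A).real {ω | j ∈ p.2 ω}ᶜ = 1 - (M.P A).real {ω | j ∈ p.2 ω} :=
        probReal_compl_eq_one_sub (hp.1.measurableSet_mem j)
      rw [max_eq_left hαβ]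
      linarith

theorem measureReal_gapStar_ne_le (M : StreamModel.{u} J) {A : Finset (Fin J)} (hA : A.card = m)
    (hm : 1 ≤ m) (hmJ : m ≤ J - 1) (hα : α ∈ Set.Ioo (0 : ℝ) 1) (hβ : β ∈ Set.Ioo (0 : ℝ) 1) :
    (M.P A).real {ω | (M.gapStar m α β).2 ω ≠ A} ≤ min α β := by
  have hT : M.IsTest (M.gapStar m α β) := M.isTest_gapRule _ _
  refine le_trans ?_ (M.integral_card_sdiff_gapStar_le hA hm hmJ hα hβ)
  rw [← integral_indicator_one (hT.measurableSet fun D => D ≠ A)]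
  refine integral_mono ((integrable_const _).indicator (hT.measurableSet fun D => D ≠ A))
    (hT.integrable A fun D => ((D \ A).card : ℝ)) fun ω => ?_
  by_cases hω : (M.gapStar m α β).2 ω = A
  · simp [hω]
  · rw [Set.indicator_of_mem (by exact hω)]
    have hne : ((M.gapStar m α β).2 ω \ A).Nonempty := by
      rw [Finset.sdiff_nonempty]
      intro hs
      exact hω (Finset.eq_of_subset_of_card_le hs (by
        rw [hA]; exact (M.card_gapRule hmJ _ ω).ge))
    simp only [Pi.one_apply]
    exact_mod_cast Finset.card_pos.2 hne

/-- The information lower bound for the gap rule. -/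
theorem IsIID.le_expTime_gapStar (h : M.IsIID) (hf : M.FiniteInformation) {A : Finset (Fin J)}
    (hA : A.card = m) (hm : 1 ≤ m) (hmJ : m ≤ J - 1) (hη : 0 < M.η₁ A + M.η₀ A)
    (hα : α ∈ Set.Ioo (0 : ℝ) 1) (hβ : β ∈ Set.Ioo (0 : ℝ) 1) :
    ENNReal.ofReal ((|Real.log (min α β)| * (1 - min α β) - 1) / (M.η₁ A + M.η₀ A)) ≤
      M.expTime A (M.gapStar m α β).1 := by
  obtain ⟨i, hi, j, hj, he⟩ := h.exists_drift_sub_eq hA hm hmJ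
  have hB : (insert j (A.erase i)).card = m := (card_swap hi hj).trans hA
  have hmin : 0 < min α β := lt_min hα.1 hβ.1
  obtain ⟨hT, hD⟩ := M.isTest_gapRule m (threshold J m α β)
  have hF : MeasurableSet[hT.measurableSpace] {ω | (M.gapStar m α β).2 ω = A} := by
    have : {ω | (M.gapStar m α β).2 ω = A} =
        ⋂ k ∈ {k | k ∈ A}, {ω | k ∈ (M.gapStar m α β).2 ω} ∩
          ⋂ k ∈ {k | k ∉ A}, {ω | k ∈ (M.gapStar m α β).2 ω}ᶜ := by
      ext ω
      simp only [Set.mem_ofPred_eq, Set.mem_iInter, Set.mem_inter_iff, Set.mem_compl_iff]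
      constructor
      · intro hω k hk
        rw [hω]
        exact ⟨hk, fun l hl => hl⟩
      · intro hω
        ext k
        exact ⟨fun hk => by_contra fun hkA => (hω i hi).2 k hkA hk, fun hk => (hω k hk).1⟩
    rw [this]
    exact MeasurableSet.biInter (Set.to_countable _) fun k _ => (hD k).inter
      (MeasurableSet.biInter (Set.to_countable _) fun k _ => (hD k).compl)
  have hq : (M.P (insert j (A.erase i))).real {ω | (M.gapStar m α β).2 ω = A} ≤ min α β := by
    refine le_trans (measureReal_mono fun ω (hω : _ = A) => ?_)
      (M.measureReal_gapStar_ne_le hB hm hmJ hα hβ)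
    intro h'
    exact hj (by rw [← hω, h']; simp)
  have hp : 1 - min α β ≤ (M.P A).real {ω | (M.gapStar m α β).2 ω = A} := by
    have h1 := M.measureReal_gapStar_ne_le hA hm hmJ hα hβ
    have h2 : (M.P A).real {ω | (M.gapStar m α β).2 ω = A}ᶜ =
        1 - (M.P A).real {ω | (M.gapStar m α β).2 ω = A} :=
      probReal_compl_eq_one_sub (hT.measurableSpace_le _ hF)
    change (M.P A).real {ω | (M.gapStar m α β).2 ω = A}ᶜ ≤ _ at h1
    linarith
  have hexp : Real.exp |Real.log (min α β)| * min α β = 1 := by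
    rw [abs_log_min hα hβ, Real.exp_neg, Real.exp_log hmin, inv_mul_cancel₀ hmin.ne']
  refine le_trans (ENNReal.ofReal_le_ofReal ?_) (h.le_expTime hf hi hj hT
    (M.ae_gapT_ne_top hA hm hmJ (threshold_pos hm hmJ hα hβ)) hF
    (a := |Real.log (min α β)|)
    ((mul_le_mul_of_nonneg_left hq (Real.exp_nonneg _)).trans hexp.le) (he ▸ hη))
  rw [he]
  exact div_le_div_of_nonneg_right
    (sub_le_sub_right (mul_le_mul_of_nonneg_left hp (abs_nonneg _)) _) hη.le

theorem optTime_le_gapStar (M : StreamModel.{u} J) (A : Finset (Fin J)) (hm : 1 ≤ m)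
    (hmJ : m ≤ J - 1) (hα : α ∈ Set.Ioo (0 : ℝ) 1) (hβ : β ∈ Set.Ioo (0 : ℝ) 1) :
    M.optTime m A α β ≤ M.expTime A (M.gapStar m α β).1 :=
  iInf₂_le _ (M.gapStar_mem_control hm hmJ hα hβ)

theorem IsIID.map_firstObs_one_ne (h : M.IsIID) (j : Fin J) :
    (M.P₁ j).map (firstObs 1) ≠ (M.P₀ j).map (firstObs 1) := by
  intro he
  have hm : ((M.P₁ j).map fun x => x 0) = (M.P₀ j).map fun x => x 0 := by
    have e : ∀ R : Measure (ℕ → M.E j), (R.map fun x => x 0) =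
        (R.map (firstObs 1)).map fun y => y 0 := fun R => by
      rw [Measure.map_map (measurable_pi_apply 0) (measurable_firstObs 1)]
      rfl
    rw [e, e, he]
  have hn : ∀ n, (M.P₁ j).map (firstObs n) = (M.P₀ j).map (firstObs n) := fun n => by
    rw [(h j).1.map_firstObs, (h j).2.map_firstObs, hm]
  have hz : ∀ᵐ x ∂(M.P₁ j), ∀ n, streamLLR (M.P₀ j) (M.P₁ j) n x = 0 := by
    rw [ae_all_iff]
    intro n
    have : IsProbabilityMeasure ((M.P₁ j).map (firstObs n)) :=
      Measure.isProbabilityMeasure_map (measurable_firstObs n).aemeasurable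
    filter_upwards [ae_of_ae_map (measurable_firstObs n).aemeasurable
      (llr_self ((M.P₁ j).map (firstObs n)))] with x hx
    rw [streamLLR, ← hn n, hx, Pi.zero_apply]
  obtain ⟨x, hx, hx'⟩ := (hz.and (M.llr_alt j)).exists
  simp only [hx] at hx'
  exact not_tendsto_const_atTop _ _ hx'

theorem _root_.InformationTheory.integral_llr_pos {X : Type*} [MeasurableSpace X]
    {μ ν : Measure X} [IsProbabilityMeasure μ] [IsProbabilityMeasure ν] (hμν : μ ≪ ν)
    (hne : μ ≠ ν) (hi : Integrable (llr μ ν) μ) : 0 < ∫ x, llr μ ν x ∂μ := by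
  rw [← InformationTheory.toReal_klDiv_of_measure_eq hμν (by simp)]
  refine ENNReal.toReal_pos (fun h0 => hne (InformationTheory.klDiv_eq_zero_iff.1 h0)) ?_
  exact InformationTheory.klDiv_ne_top hμν hi

theorem IsIID.information_pos (h : M.IsIID) (hf : M.FiniteInformation) (j : Fin J) :
    0 < M.I₀ j ∧ 0 < M.I₁ j := by
  have hφ := measurable_firstObs (E := M.E j) 1
  have hp₀ : IsProbabilityMeasure ((M.P₀ j).map (firstObs 1)) :=
    Measure.isProbabilityMeasure_map hφ.aemeasurable
  have hp₁ : IsProbabilityMeasure ((M.P₁ j).map (firstObs 1)) :=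
    Measure.isProbabilityMeasure_map hφ.aemeasurable
  have hne := h.map_firstObs_one_ne j
  set μ₀ := (M.P₀ j).map (firstObs 1) with hμ₀
  set μ₁ := (M.P₁ j).map (firstObs 1) with hμ₁
  have hlm : Measurable (llr μ₁ μ₀) := measurable_llr _ _
  have hi₀ : Integrable (llr μ₁ μ₀) μ₀ :=
    (integrable_map_measure hlm.aestronglyMeasurable hφ.aemeasurable).2 (hf j).1
  have hi₁ : Integrable (llr μ₁ μ₀) μ₁ :=
    (integrable_map_measure hlm.aestronglyMeasurable hφ.aemeasurable).2 (hf j).2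
  have hneg : llr μ₀ μ₁ =ᵐ[μ₀] fun x => -llr μ₁ μ₀ x := by
    filter_upwards [neg_llr (M.ac₀₁ j 1)] with x hx
    rw [← hx, Pi.neg_apply, neg_neg]
  constructor
  · have h0 := InformationTheory.integral_llr_pos (M.ac₀₁ j 1) hne.symm
      ((integrable_congr hneg).2 hi₀.neg)
    have e0 : ∫ y, -llr μ₁ μ₀ y ∂μ₀ = M.I₀ j :=
      integral_map hφ.aemeasurable hlm.neg.aestronglyMeasurable
    rwa [integral_congr_ae hneg, e0] at h0
  · have h1 := InformationTheory.integral_llr_pos (M.ac₁₀ j 1) hne hi₁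
    have e1 : ∫ y, llr μ₁ μ₀ y ∂μ₁ = M.I₁ j :=
      integral_map hφ.aemeasurable hlm.aestronglyMeasurable
    rwa [e1] at h1

end StreamModel

end SeqTest

namespace SeqTest

theorem tendsto_div_ofReal_one {ι : Type*} {l : Filter ι} {e : ι → ℝ≥0∞} {ρ : ι → ℝ}
    (hρ : ∀ᶠ k in l, 0 < ρ k)
    (hlo : ∀ ε : ℝ, 0 < ε → ε ≤ 1 → ∀ᶠ k in l, ENNReal.ofReal ((1 - ε) * ρ k) ≤ e k)
    (hup : ∀ ε : ℝ, 0 < ε → ε ≤ 1 → ∀ᶠ k in l, e k ≤ ENNReal.ofReal ((1 + ε) * ρ k)) :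
    Tendsto (fun k => e k / ENNReal.ofReal (ρ k)) l (𝓝 1) := by
  rw [ENNReal.tendsto_nhds ENNReal.one_ne_top]
  intro ε hε
  have hne : min ε 1 ≠ ⊤ := ne_top_of_le_ne_top ENNReal.one_ne_top (min_le_right _ _)
  have hpos : 0 < (min ε 1).toReal := ENNReal.toReal_pos (lt_min hε one_pos).ne' hne
  have hle : (min ε 1).toReal ≤ 1 := by
    have := ENNReal.toReal_mono ENNReal.one_ne_top (min_le_right ε 1)
    simpa using this
  have hδ : ENNReal.ofReal (min ε 1).toReal ≤ ε := by
    rw [ENNReal.ofReal_toReal hne]; exact min_le_left _ _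
  filter_upwards [hρ, hlo _ hpos hle, hup _ hpos hle] with k h0 h1 h2
  have hr0 : ENNReal.ofReal (ρ k) ≠ 0 := (ENNReal.ofReal_pos.2 h0).ne'
  constructor
  · rw [ENNReal.le_div_iff_mul_le (Or.inl hr0) (Or.inl ENNReal.ofReal_ne_top)]
    rw [ENNReal.ofReal_mul (by linarith), ENNReal.ofReal_sub _ hpos.le, ENNReal.ofReal_one] at h1
    exact le_trans (by gcongr) h1
  · rw [ENNReal.div_le_iff hr0 ENNReal.ofReal_ne_top]
    rw [ENNReal.ofReal_mul (by linarith), ENNReal.ofReal_add zero_le_one hpos.le,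
      ENNReal.ofReal_one] at h2
    exact h2.trans (by gcongr)

theorem threshold_le {J m : ℕ} (hm : 1 ≤ m) (hmJ : m ≤ J - 1) (α β : ℝ) :
    threshold J m α β ≤ |Real.log (min α β)| + 2 * Real.log J := by
  have hmJ' : (m : ℝ) + 1 ≤ J := by exact_mod_cast (by omega : m + 1 ≤ J)
  have hm' : (1 : ℝ) ≤ m := by exact_mod_cast hm
  have h : Real.log ((m : ℝ) * ((J : ℝ) - m)) ≤ Real.log ((J : ℝ) ^ 2) :=
    Real.log_le_log (mul_pos (by linarith) (by linarith)) (by nlinarith)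
  rw [Real.log_pow] at h
  unfold threshold
  push_cast at h
  linarith

namespace StreamModel

variable {J : ℕ} {M : StreamModel.{u} J} {m : ℕ} {α β : ℝ}

theorem IsIID.expTime_gapStar_le_mul_rate (h : M.IsIID) (hf : M.FiniteInformation)
    {A : Finset (Fin J)} (hA : A.card = m) (hm : 1 ≤ m) (hmJ : m ≤ J - 1)
    (hη : 0 < M.η₁ A + M.η₀ A) (hα : α ∈ Set.Ioo (0 : ℝ) 1) (hβ : β ∈ Set.Ioo (0 : ℝ) 1)
    {ε : ℝ} (hε0 : 0 < ε) (hε1 : ε ≤ 1) {N : ℕ} (hN : 1 ≤ N)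
    (hJ : 2 * Real.log J ≤ ε / 4 * |Real.log (min α β)|)
    (hNη : N * (M.η₁ A + M.η₀ A) ≤ ε / 4 * |Real.log (min α β)|)
    (hdev : M.deviation A N ≤ ε / 4 * (N * (M.η₁ A + M.η₀ A))) :
    M.expTime A (M.gapStar m α β).1 ≤ ENNReal.ofReal ((1 + ε) * M.rate A α β) := by
  set η := M.η₁ A + M.η₀ A with hηdef
  have hc := threshold_le hm hmJ α β
  have hN' : (0 : ℝ) < N := by exact_mod_cast hN
  have hNη0 : 0 < N * η := mul_pos hN' hη
  have hdev' : M.deviation A N < N * η := by nlinarith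
  refine (h.expTime_gapT_le hf hA hm hmJ (threshold_pos hm hmJ hα hβ) hN hη.le
    (fun i hi j hj => h.le_drift_sub hi hj) hdev').trans (ENNReal.ofReal_le_ofReal ?_)
  unfold rate
  rw [← hηdef]
  set L := |Real.log (min α β)| with hL
  have hL0 : 0 ≤ L := abs_nonneg _
  have hd : (1 - ε / 4) * (N * η) ≤ N * η - M.deviation A N := by linarith
  have hq : 0 < 1 - ε / 4 := by linarith
  have hnum : 0 ≤ threshold J m α β + N * η := by
    linarith [threshold_pos hm hmJ hα hβ]
  calc N * ((threshold J m α β + N * η) / (N * η - M.deviation A N))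
      ≤ N * ((threshold J m α β + N * η) / ((1 - ε / 4) * (N * η))) :=
        mul_le_mul_of_nonneg_left (div_le_div_of_nonneg_left hnum (mul_pos hq hNη0) hd) hN'.le
    _ = (threshold J m α β + N * η) / (1 - ε / 4) / η := by field_simp
    _ ≤ ((1 + ε) * L) / η := by
        refine div_le_div_of_nonneg_right ?_ hη.le
        rw [div_le_iff₀ hq]
        nlinarith [mul_nonneg hε0.le hL0, mul_nonneg (mul_nonneg hε0.le hL0) (sub_nonneg.2 hε1)]
    _ = (1 + ε) * (L / η) := mul_div_assoc _ _ _

theorem IsIID.mul_rate_le_expTime_gapStar (h : M.IsIID) (hf : M.FiniteInformation)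
    {A : Finset (Fin J)} (hA : A.card = m) (hm : 1 ≤ m) (hmJ : m ≤ J - 1)
    (hη : 0 < M.η₁ A + M.η₀ A) (hα : α ∈ Set.Ioo (0 : ℝ) 1) (hβ : β ∈ Set.Ioo (0 : ℝ) 1)
    {ε : ℝ} (hL : 1 ≤ ε / 2 * |Real.log (min α β)|) (hmin : min α β ≤ ε / 2) :
    ENNReal.ofReal ((1 - ε) * M.rate A α β) ≤ M.expTime A (M.gapStar m α β).1 := by
  refine le_trans (ENNReal.ofReal_le_ofReal ?_) (h.le_expTime_gapStar hf hA hm hmJ hη hα hβ)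
  rw [rate, ← mul_div_assoc]
  refine div_le_div_of_nonneg_right ?_ hη.le
  nlinarith [mul_le_mul_of_nonneg_left hmin (abs_nonneg (Real.log (min α β)))]

theorem IsIID.mul_rate_le_optTime (h : M.IsIID) (hf : M.FiniteInformation)
    {A : Finset (Fin J)} (hA : A.card = m) (hm : 1 ≤ m) (hmJ : m ≤ J - 1)
    (hη : 0 < M.η₁ A + M.η₀ A) (hα : α ∈ Set.Ioo (0 : ℝ) 1) (hβ : β ∈ Set.Ioo (0 : ℝ) 1)
    {ε : ℝ} (hε0 : 0 < ε) (hε1 : ε ≤ 1) (hL : 1 ≤ ε / 3 * |Real.log (min α β)|)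
    (hJ : Real.log J ≤ ε / 3 * |Real.log (min α β)|) (hmax : J * max α β ≤ ε / 3) :
    ENNReal.ofReal ((1 - ε) * M.rate A α β) ≤ M.optTime m A α β := by
  have hL0 := abs_nonneg (Real.log (min α β))
  refine le_trans (ENNReal.ofReal_le_ofReal ?_)
    (h.le_optTime hf hA hm hmJ hη hα hβ (hJ.trans (by nlinarith)))
  rw [rate, ← mul_div_assoc]
  refine div_le_div_of_nonneg_right ?_ hη.le
  set L := |Real.log (min α β)|
  have h1 : (1 - ε / 3) * L ≤ L - Real.log J := by linarith
  have h2 : 1 - ε / 3 ≤ 1 - J * max α β := by linarith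
  have h3 := mul_le_mul h1 h2 (by linarith) ((mul_nonneg (by linarith) hL0).trans h1)
  nlinarith [mul_nonneg (sq_nonneg ε) hL0]

theorem IsIID.tendsto_deviation_div (h : M.IsIID) (hf : M.FiniteInformation)
    (A : Finset (Fin J)) : Tendsto (fun N : ℕ => M.deviation A N / N) atTop (𝓝 0) := by
  have hj : ∀ j, Tendsto (fun N : ℕ =>
      (∫ x, |∑ i ∈ Finset.range N, M.step j (x i) - N * M.drift A j| ∂(M.law A j)) / N)
      atTop (𝓝 0) := by
    intro j
    have hs := strong_law_Lp (μ := M.law A j) le_rfl ENNReal.one_ne_top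
      (fun (i : ℕ) (x : ℕ → M.E j) => M.step j (x i))
      (memLp_one_iff_integrable.2 (h.integrable_step hf A j))
      (fun a b hab => (h.indepFun_step A j).indepFun hab) (h.identDistrib_step A j)
    have hs' := (ENNReal.tendsto_toReal ENNReal.zero_ne_top).comp hs
    rw [ENNReal.toReal_zero] at hs'
    refine hs'.congr' ?_
    filter_upwards [eventually_ge_atTop 1] with N hN
    have hN' : (0 : ℝ) < N := by exact_mod_cast hN
    rw [Function.comp_apply, eLpNorm_one_eq_lintegral_enorm, ← integral_norm_eq_lintegral_enorm,
      ← integral_div]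
    · refine integral_congr_ae (Eventually.of_forall fun x => ?_)
      change ‖(N : ℝ)⁻¹ • ∑ i ∈ Finset.range N, M.step j (x i) - M.drift A j‖ =
        |∑ i ∈ Finset.range N, M.step j (x i) - N * M.drift A j| / N
      have e : (N : ℝ)⁻¹ * ∑ i ∈ Finset.range N, M.step j (x i) - M.drift A j =
          (∑ i ∈ Finset.range N, M.step j (x i) - N * M.drift A j) / N := by field_simp
      rw [Real.norm_eq_abs, smul_eq_mul, e, abs_div, abs_of_pos hN']
    · refine Measurable.aestronglyMeasurable ?_
      fun_prop
  have := tendsto_finsetSum (Finset.univ : Finset (Fin J)) fun j _ => hj j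
  simp only [Finset.sum_const_zero] at this
  refine this.congr fun N => ?_
  rw [deviation, Finset.sum_div]

theorem measurable_streamLLR (j : Fin J) (n : ℕ) : Measurable (streamLLR (M.P₀ j) (M.P₁ j) n) :=
  (measurable_llr _ _).comp (measurable_firstObs n)

theorem finiteInformation_of_pos (hpos : ∀ j, 0 < M.I₀ j ∧ 0 < M.I₁ j) : M.FiniteInformation :=
  fun j => ⟨integrable_neg_iff.1 (Integrable.of_integral_ne_zero (hpos j).1.ne'),
    Integrable.of_integral_ne_zero (hpos j).2.ne'⟩

theorem IsIID.memLp_step (h : M.IsIID) {v : ℝ}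
    (hv : ∀ j, M.v₀ j ≤ ENNReal.ofReal v ∧ M.v₁ j ≤ ENNReal.ofReal v) (A : Finset (Fin J))
    (j : Fin J) : MemLp (fun x : ℕ → M.E j => M.step j (x 0)) 2 (M.law A j) ∧
      variance (fun x : ℕ → M.E j => M.step j (x 0)) (M.law A j) ≤ max v 0 := by
  have hev : evariance (streamLLR (M.P₀ j) (M.P₁ j) 1) (M.law A j) ≤ ENNReal.ofReal v := by
    unfold StreamModel.law; split_ifs
    exacts [(hv j).2, (hv j).1]
  have hlp := (evariance_lt_top_iff_memLp (μ := M.law A j)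
    (M.measurable_streamLLR j 1).aestronglyMeasurable).1 (hev.trans_lt ENNReal.ofReal_lt_top)
  refine ⟨hlp.ae_eq (h.streamLLR_one A j), ?_⟩
  rw [← variance_congr (h.streamLLR_one A j), variance, ← ENNReal.toReal_ofReal']
  exact ENNReal.toReal_mono ENNReal.ofReal_ne_top hev

theorem IsIID.deviation_le (h : M.IsIID) {v : ℝ}
    (hv : ∀ j, M.v₀ j ≤ ENNReal.ofReal v ∧ M.v₁ j ≤ ENNReal.ofReal v) (A : Finset (Fin J))
    (N : ℕ) {s : ℝ} (hs : 0 < s) :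
    M.deviation A N ≤ J * (s / 2 + N * max v 0 / (2 * s)) := by
  have hj : ∀ j, ∫ x, |∑ i ∈ Finset.range N, M.step j (x i) - N * M.drift A j| ∂(M.law A j) ≤
      s / 2 + N * max v 0 / (2 * s) := by
    intro j
    obtain ⟨hlp, hvar⟩ := h.memLp_step hv A j
    have hlpi : ∀ i : ℕ, MemLp (fun x : ℕ → M.E j => M.step j (x i)) 2 (M.law A j) := fun i =>
      (h.identDistrib_step A j i).symm.memLp_snd hlp
    have hmean : ∫ x, (∑ i ∈ Finset.range N, fun x : ℕ → M.E j => M.step j (x i)) x ∂(M.law A j) =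
        N * M.drift A j := by
      simp only [Finset.sum_apply]
      rw [integral_finsetSum _ fun i _ => (hlpi i).integrable one_le_two]
      simp only [(h.identDistrib_step A j _).integral_eq]
      rw [Finset.sum_const, Finset.card_range, nsmul_eq_mul, drift]
    have hVar : variance (∑ i ∈ Finset.range N, fun x : ℕ → M.E j => M.step j (x i))
        (M.law A j) ≤ N * max v 0 := by
      rw [IndepFun.variance_sum (fun i _ => hlpi i)
        fun a _ b _ hab => (h.indepFun_step A j).indepFun hab]
      simp only [(h.identDistrib_step A j _).variance_eq]
      rw [Finset.sum_const, Finset.card_range, nsmul_eq_mul]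
      exact mul_le_mul_of_nonneg_left hvar (Nat.cast_nonneg _)
    have hSlp : MemLp (∑ i ∈ Finset.range N, fun x : ℕ → M.E j => M.step j (x i)) 2
        (M.law A j) := memLp_finsetSum' _ fun i _ => hlpi i
    rw [variance_eq_integral hSlp.aestronglyMeasurable.aemeasurable, hmean] at hVar
    have hdlp := hSlp.sub (memLp_const (N * M.drift A j))
    have hd1 : Integrable (fun x : ℕ → M.E j => ∑ i ∈ Finset.range N, M.step j (x i) -
        N * M.drift A j) (M.law A j) :=
      (hdlp.integrable one_le_two).congr (Eventually.of_forall fun x => by simp)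
    have hd2 := hdlp.integrable_sq
    simp only [Finset.sum_apply, Pi.sub_apply] at hVar hd2
    calc ∫ x, |∑ i ∈ Finset.range N, M.step j (x i) - N * M.drift A j| ∂(M.law A j)
        ≤ ∫ x, (s / 2 + (∑ i ∈ Finset.range N, M.step j (x i) - N * M.drift A j) ^ 2 / (2 * s))
          ∂(M.law A j) := by
          refine integral_mono hd1.abs ((integrable_const _).add (hd2.div_const _)) fun x => ?_
          simp only
          rw [← sq_abs, ← sub_le_iff_le_add', le_div_iff₀ (by positivity)]
          nlinarith [sq_nonneg (|∑ i ∈ Finset.range N, M.step j (x i) - N * M.drift A j| - s)]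
      _ ≤ _ := by
          rw [integral_add (integrable_const _) (hd2.div_const _)]
          simp only [integral_div, integral_const, probReal_univ, one_smul]
          gcongr
  calc M.deviation A N ≤ ∑ _j : Fin J, (s / 2 + N * max v 0 / (2 * s)) :=
        Finset.sum_le_sum fun j _ => hj j
    _ = _ := by rw [Finset.sum_const, Finset.card_univ, Fintype.card_fin, nsmul_eq_mul]

end StreamModel

theorem tendsto_abs_log_min {ι : Type*} {l : Filter ι} {α β : ι → ℝ} (hα : Tendsto α l (𝓝 0))
    (hα' : ∀ᶠ k in l, α k ∈ Set.Ioo (0 : ℝ) 1) (hβ' : ∀ᶠ k in l, β k ∈ Set.Ioo (0 : ℝ) 1) :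
    Tendsto (fun k => min (α k) (β k)) l (𝓝 0) ∧
      Tendsto (fun k => |Real.log (min (α k) (β k))|) l atTop := by
  have h1 : ∀ᶠ k in l, 0 < min (α k) (β k) := by
    filter_upwards [hα', hβ'] with k h h' using lt_min h.1 h'.1
  have h2 : Tendsto (fun k => min (α k) (β k)) l (𝓝 0) :=
    tendsto_of_tendsto_of_tendsto_of_le_of_le' tendsto_const_nhds hα
      (h1.mono fun k hk => hk.le) (Eventually.of_forall fun k => min_le_left _ _)
  refine ⟨h2, tendsto_abs_atBot_atTop.comp (Real.tendsto_log_nhdsGT_zero.comp ?_)⟩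
  exact tendsto_nhdsWithin_iff.2 ⟨h2, h1⟩

end SeqTest

namespace SeqTest

variable {J m : ℕ} {M : StreamModel.{u} J}

theorem StreamModel.IsIID.tendsto_fixed (h : M.IsIID) (hf : M.FiniteInformation)
    {A : Finset (Fin J)} (hA : A.card = m) (hm : 1 ≤ m) (hmJ : m ≤ J - 1) :
    Tendsto (fun ab : ℝ × ℝ => M.expTime A (M.gapStar m ab.1 ab.2).1 /
        ENNReal.ofReal (M.rate A ab.1 ab.2)) (𝓝[>] 0 ×ˢ 𝓝[>] 0) (𝓝 1) ∧
      Tendsto (fun ab : ℝ × ℝ => M.optTime m A ab.1 ab.2 /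
        ENNReal.ofReal (M.rate A ab.1 ab.2)) (𝓝[>] 0 ×ˢ 𝓝[>] 0) (𝓝 1) := by
  set l : Filter (ℝ × ℝ) := 𝓝[>] 0 ×ˢ 𝓝[>] 0 with hl
  have hη : 0 < M.η₁ A + M.η₀ A :=
    StreamModel.η₁_add_η₀_pos (h.information_pos hf) h hA hm hmJ
  have hα : ∀ᶠ ab in l, ab.1 ∈ Set.Ioo (0 : ℝ) 1 :=
    tendsto_fst.eventually (Ioo_mem_nhdsGT zero_lt_one)
  have hβ : ∀ᶠ ab in l, ab.2 ∈ Set.Ioo (0 : ℝ) 1 :=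
    tendsto_snd.eventually (Ioo_mem_nhdsGT zero_lt_one)
  have hα0 : Tendsto (fun ab : ℝ × ℝ => ab.1) l (𝓝 0) :=
    (tendsto_nhdsWithin_iff.1 tendsto_fst).1
  have hβ0 : Tendsto (fun ab : ℝ × ℝ => ab.2) l (𝓝 0) :=
    (tendsto_nhdsWithin_iff.1 tendsto_snd).1
  obtain ⟨hmin, hL⟩ := tendsto_abs_log_min hα0 hα hβ
  have hmax : Tendsto (fun ab : ℝ × ℝ => J * max ab.1 ab.2) l (𝓝 0) := by
    simpa using (hα0.max hβ0).const_mul (J : ℝ)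
  have hrate : ∀ᶠ ab in l, 0 < M.rate A ab.1 ab.2 := by
    filter_upwards [hL.eventually_gt_atTop 0] with ab hab using div_pos hab hη
  have hLε : ∀ κ C : ℝ, 0 < κ → ∀ᶠ ab in l, C ≤ κ * |Real.log (min ab.1 ab.2)| := fun κ C hκ =>
    (hL.const_mul_atTop hκ).eventually_ge_atTop C
  have hup : ∀ ε : ℝ, 0 < ε → ε ≤ 1 → ∀ᶠ ab in l, M.expTime A (M.gapStar m ab.1 ab.2).1 ≤
      ENNReal.ofReal ((1 + ε) * M.rate A ab.1 ab.2) := by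
    intro ε hε0 hε1
    have hpos : 0 < ε / 4 * (M.η₁ A + M.η₀ A) := by positivity
    obtain ⟨N, hN, hN1⟩ := (((h.tendsto_deviation_div hf A).eventually_lt_const hpos).and
      (eventually_ge_atTop 1)).exists
    have hN' : (0 : ℝ) < N := by exact_mod_cast hN1
    rw [div_lt_iff₀ hN'] at hN
    filter_upwards [hα, hβ, hLε (ε / 4) (2 * Real.log J) (by positivity),
      hLε (ε / 4) (N * (M.η₁ A + M.η₀ A)) (by positivity)] with ab h1 h2 h3 h4
    exact h.expTime_gapStar_le_mul_rate hf hA hm hmJ hη h1 h2 hε0 hε1 hN1 h3 h4 (by linarith)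
  refine ⟨tendsto_div_ofReal_one hrate (fun ε hε0 hε1 => ?_) hup,
    tendsto_div_ofReal_one hrate (fun ε hε0 hε1 => ?_) fun ε hε0 hε1 => ?_⟩
  · filter_upwards [hα, hβ, hLε (ε / 2) 1 (by positivity),
      hmin.eventually_le_const (show 0 < ε / 2 by positivity)] with ab h1 h2 h3 h4
    exact h.mul_rate_le_expTime_gapStar hf hA hm hmJ hη h1 h2 h3 h4
  · filter_upwards [hα, hβ, hLε (ε / 3) 1 (by positivity), hLε (ε / 3) (Real.log J) (by positivity),
      hmax.eventually_le_const (show 0 < ε / 3 by positivity)] with ab h1 h2 h3 h4 h5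
    exact h.mul_rate_le_optTime hf hA hm hmJ hη h1 h2 hε0 hε1 h3 h4 h5
  · filter_upwards [hα, hβ, hup ε hε0 hε1] with ab h1 h2 h3
    exact (M.optTime_le_gapStar A hm hmJ h1 h2).trans h3

theorem tendsto_varying {ι : Type v} {l : Filter ι} {α β : ι → ℝ} {J m : ι → ℕ}
    {M : ∀ k, StreamModel.{u} (J k)} {A : ∀ k, Finset (Fin (J k))}
    (hα : ∀ k, α k ∈ Set.Ioo (0 : ℝ) 1) (hβ : ∀ k, β k ∈ Set.Ioo (0 : ℝ) 1)
    (hα0 : Tendsto α l (𝓝 0)) (hm : ∀ k, 1 ≤ m k ∧ m k ≤ J k - 1)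
    (hJ : (fun k => (J k : ℝ)) =o[l] (fun k => |Real.log (min (α k) (β k))| ^ (1 / 4 : ℝ)))
    {δ : ℝ} (hδ : 0 < δ) (hI : ∀ k j, δ ≤ (M k).I₀ j ∧ δ ≤ (M k).I₁ j) {v : ℝ}
    (hv : ∀ k j, (M k).v₀ j ≤ ENNReal.ofReal v ∧ (M k).v₁ j ≤ ENNReal.ofReal v)
    (hA : ∀ k, (A k).card = m k) {b : ℝ} (hb : ∀ k, (M k).η₁ (A k) + (M k).η₀ (A k) ≤ b)
    (h : ∀ k, (M k).IsIID) :
    Tendsto (fun k => (M k).expTime (A k) ((M k).gapStar (m k) (α k) (β k)).1 /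
        ENNReal.ofReal ((M k).rate (A k) (α k) (β k))) l (𝓝 1) ∧
      (Tendsto (fun k => (J k : ℝ) * max (α k) (β k)) l (𝓝 0) →
        Tendsto (fun k => (M k).optTime (m k) (A k) (α k) (β k) /
          ENNReal.ofReal ((M k).rate (A k) (α k) (β k))) l (𝓝 1)) := by
  have hpos : ∀ k j, 0 < (M k).I₀ j ∧ 0 < (M k).I₁ j := fun k j =>
    ⟨hδ.trans_le (hI k j).1, hδ.trans_le (hI k j).2⟩
  have hf : ∀ k, (M k).FiniteInformation := fun k =>
    StreamModel.finiteInformation_of_pos (hpos k)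
  have hη2 : ∀ k, 2 * δ ≤ (M k).η₁ (A k) + (M k).η₀ (A k) := by
    intro k
    obtain ⟨i, hi, j, hj, he⟩ := (h k).exists_drift_sub_eq (hA k) (hm k).1 (hm k).2
    rw [← he, (h k).drift_of_mem hi, (h k).drift_of_notMem hj]
    linarith [(hI k i).2, (hI k j).1]
  have hη : ∀ k, 0 < (M k).η₁ (A k) + (M k).η₀ (A k) := fun k => by linarith [hη2 k]
  obtain ⟨hmin, hL⟩ := tendsto_abs_log_min hα0 (Eventually.of_forall hα) (Eventually.of_forall hβ)
  have hLε : ∀ κ C : ℝ, 0 < κ → ∀ᶠ k in l, C ≤ κ * |Real.log (min (α k) (β k))| := fun κ C hκ =>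
    (hL.const_mul_atTop hκ).eventually_ge_atTop C
  have hJ1 : ∀ k, (1 : ℝ) ≤ J k := fun k => by
    have := hm k
    exact_mod_cast (by omega : 1 ≤ J k)
  have hJ2 : ∀ κ : ℝ, 0 < κ → ∀ᶠ k in l, (J k : ℝ) ^ 2 ≤ κ * |Real.log (min (α k) (β k))| := by
    intro κ hκ
    filter_upwards [hJ.def (Real.sqrt_pos.2 hκ), hL.eventually_ge_atTop 1] with k hk hk1
    set L := |Real.log (min (α k) (β k))|
    have hL0 : 0 ≤ L := zero_le_one.trans hk1
    rw [Real.norm_of_nonneg (Nat.cast_nonneg _),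
      Real.norm_of_nonneg (Real.rpow_nonneg hL0 _)] at hk
    have h1 : (L ^ (1 / 4 : ℝ)) ^ 2 ≤ L := by
      rw [← Real.rpow_natCast, ← Real.rpow_mul hL0]
      calc L ^ ((1 / 4 : ℝ) * (2 : ℕ)) ≤ L ^ (1 : ℝ) :=
            Real.rpow_le_rpow_of_exponent_le hk1 (by norm_num)
        _ = L := Real.rpow_one L
    calc (J k : ℝ) ^ 2 ≤ (√κ * L ^ (1 / 4 : ℝ)) ^ 2 := by gcongr
      _ = κ * (L ^ (1 / 4 : ℝ)) ^ 2 := by rw [mul_pow, Real.sq_sqrt hκ.le]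
      _ ≤ κ * L := by gcongr
  have hlogJ : ∀ k, Real.log (J k) ≤ (J k : ℝ) ^ 2 := fun k =>
    (Real.log_le_sub_one_of_pos (by linarith [hJ1 k])).trans (by nlinarith [hJ1 k])
  have hrate : ∀ᶠ k in l, 0 < (M k).rate (A k) (α k) (β k) := by
    filter_upwards [hL.eventually_gt_atTop 0] with k hk using div_pos hk (hη k)
  have hup : ∀ ε : ℝ, 0 < ε → ε ≤ 1 → ∀ᶠ k in l,
      (M k).expTime (A k) ((M k).gapStar (m k) (α k) (β k)).1 ≤
        ENNReal.ofReal ((1 + ε) * (M k).rate (A k) (α k) (β k)) := by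
    intro ε hε0 hε1
    set w := max v 0 with hw
    have hw0 : 0 ≤ w := le_max_right _ _
    obtain ⟨K, hK⟩ := exists_nat_ge ((1 + w) / (ε * δ) + 1)
    have hKw : (1 + w) / (ε * δ) ≤ K := by linarith
    have hK1 : (1 : ℝ) ≤ K := by
      have : 0 ≤ (1 + w) / (ε * δ) := by positivity
      linarith
    rw [div_le_iff₀ (by positivity)] at hKw
    have hb0 : 0 < |b| + 1 := by positivity
    filter_upwards [hJ2 (ε / 8) (by positivity),
      hJ2 (ε / 4 / (K ^ 2 * (|b| + 1))) (by positivity)] with k h1 h2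
    have hJk := hJ1 k
    have hN1 : 1 ≤ (K * J k) ^ 2 := by
      refine Nat.one_le_pow _ _ (Nat.mul_pos ?_ ?_)
      · exact_mod_cast (zero_lt_one.trans_le hK1)
      · exact_mod_cast (zero_lt_one.trans_le hJk)
    refine (h k).expTime_gapStar_le_mul_rate (hf k) (hA k) (hm k).1 (hm k).2 (hη k) (hα k) (hβ k)
      hε0 hε1 hN1 (by linarith [hlogJ k]) ?_ ?_
    · rw [div_mul_eq_mul_div, le_div_iff₀ (by positivity)] at h2
      refine le_trans ?_ h2
      push_cast
      have : (M k).η₁ (A k) + (M k).η₀ (A k) ≤ |b| + 1 := by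
        linarith [hb k, le_abs_self b]
      calc ((K : ℝ) * J k) ^ 2 * ((M k).η₁ (A k) + (M k).η₀ (A k))
          ≤ (K * J k) ^ 2 * (|b| + 1) := by gcongr
        _ = J k ^ 2 * (K ^ 2 * (|b| + 1)) := by ring
    · have hs : (0 : ℝ) < K * J k := by positivity
      refine ((h k).deviation_le (hv k) (A k) _ hs).trans ?_
      push_cast
      rw [← hw]
      calc (J k : ℝ) * (K * J k / 2 + (K * J k) ^ 2 * w / (2 * (K * J k)))
          = K * J k ^ 2 * (1 + w) / 2 := by field_simp
        _ ≤ K * J k ^ 2 * (K * (ε * δ)) / 2 := by gcongr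
        _ = ε / 4 * ((K * J k) ^ 2 * (2 * δ)) := by ring
        _ ≤ ε / 4 * ((K * J k) ^ 2 * ((M k).η₁ (A k) + (M k).η₀ (A k))) := by
            gcongr
            exact hη2 k
  refine ⟨tendsto_div_ofReal_one hrate (fun ε hε0 hε1 => ?_) hup, fun hmax =>
    tendsto_div_ofReal_one hrate (fun ε hε0 hε1 => ?_) fun ε hε0 hε1 => ?_⟩
  · filter_upwards [hLε (ε / 2) 1 (by positivity),
      hmin.eventually_le_const (show 0 < ε / 2 by positivity)] with k h3 h4
    exact (h k).mul_rate_le_expTime_gapStar (hf k) (hA k) (hm k).1 (hm k).2 (hη k) (hα k) (hβ k)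
      h3 h4
  · filter_upwards [hLε (ε / 3) 1 (by positivity), hJ2 (ε / 3) (by positivity),
      hmax.eventually_le_const (show 0 < ε / 3 by positivity)] with k h3 h4 h5
    exact (h k).mul_rate_le_optTime (hf k) (hA k) (hm k).1 (hm k).2 (hη k) (hα k) (hβ k)
      hε0 hε1 h3 ((hlogJ k).trans h4) h5
  · filter_upwards [hup ε hε0 hε1] with k h3
    exact ((M k).optTime_le_gapStar (A k) (hm k).1 (hm k).2 (hα k) (hβ k)).trans h3

end SeqTest

theorem corollary3p2 :
    -- control at every pair of levels, for independent streams
    (∀ (J m : ℕ) (M : SeqTest.StreamModel.{u} J) (α β : ℝ), 1 ≤ m → m ≤ J - 1 →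
      α ∈ Set.Ioo (0 : ℝ) 1 → β ∈ Set.Ioo (0 : ℝ) 1 →
      M.gapStar m α β ∈ M.control (SeqTest.signalClass J m) α β ∧
      (∀ ω, ((M.gapStar m α β).2 ω).card = m) ∧
      ∀ A ∈ SeqTest.signalClass J m,
        M.P A {ω | 1 ≤ ((M.gapStar m α β).2 ω).card} = 1 ∧
        M.P A {ω | 1 ≤ ((M.gapStar m α β).2 ω)ᶜ.card} = 1) ∧
    -- asymptotic optimality for a fixed number of i.i.d. streams
    (∀ (J m : ℕ) (M : SeqTest.StreamModel.{u} J), 1 ≤ m → m ≤ J - 1 →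
      M.IsIID → M.FiniteInformation →
      ∀ A ∈ SeqTest.signalClass J m,
        Tendsto (fun ab : ℝ × ℝ => M.expTime A (M.gapStar m ab.1 ab.2).1 /
            ENNReal.ofReal (M.rate A ab.1 ab.2)) (𝓝[>] 0 ×ˢ 𝓝[>] 0) (𝓝 1) ∧
        Tendsto (fun ab : ℝ × ℝ => M.optTime m A ab.1 ab.2 /
            ENNReal.ofReal (M.rate A ab.1 ab.2)) (𝓝[>] 0 ×ˢ 𝓝[>] 0) (𝓝 1)) ∧
    -- streams, their number, and the number of signals vary with the levels
    (∀ (ι : Type v) (l : Filter ι) (α β : ι → ℝ) (J m : ι → ℕ)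
      (M : ∀ k, SeqTest.StreamModel.{u} (J k)) (A : ∀ k, Finset (Fin (J k))),
      (∀ k, α k ∈ Set.Ioo (0 : ℝ) 1) → (∀ k, β k ∈ Set.Ioo (0 : ℝ) 1) →
      Tendsto α l (𝓝 0) → Tendsto β l (𝓝 0) →
      (∀ k, 1 ≤ m k ∧ m k ≤ J k - 1) →
      (fun k => (J k : ℝ)) =o[l] (fun k => |Real.log (min (α k) (β k))| ^ (1 / 4 : ℝ)) →
      (∃ δ : ℝ, 0 < δ ∧ ∀ k j, δ ≤ (M k).I₀ j ∧ δ ≤ (M k).I₁ j) →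
      (∃ v : ℝ, ∀ k j, (M k).v₀ j ≤ ENNReal.ofReal v ∧ (M k).v₁ j ≤ ENNReal.ofReal v) →
      (∀ k, A k ∈ SeqTest.signalClass (J k) (m k)) →
      (∃ B : ℝ, ∀ k, (M k).η₁ (A k) + (M k).η₀ (A k) ≤ B) →
      (∀ k, (M k).gapStar (m k) (α k) (β k) ∈
        (M k).control (SeqTest.signalClass (J k) (m k)) (α k) (β k)) ∧
      ((∀ k, (M k).IsIID) →
        Tendsto (fun k => (M k).expTime (A k) ((M k).gapStar (m k) (α k) (β k)).1 /
          ENNReal.ofReal ((M k).rate (A k) (α k) (β k))) l (𝓝 1) ∧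
        (Tendsto (fun k => (J k : ℝ) * max (α k) (β k)) l (𝓝 0) →
          Tendsto (fun k => (M k).optTime (m k) (A k) (α k) (β k) /
            ENNReal.ofReal ((M k).rate (A k) (α k) (β k))) l (𝓝 1)))) := by
  refine ⟨fun J m M α β hm hmJ hα hβ => ⟨M.gapStar_mem_control hm hmJ hα hβ,
    fun ω => M.card_gapRule hmJ _ ω, fun A _ => ?_⟩,
    fun J m M hm hmJ h hf A hA => h.tendsto_fixed hf hA hm hmJ, ?_⟩
  · obtain ⟨h1, h2⟩ := M.one_le_card_gapRule (c := SeqTest.threshold J m α β) hm hmJ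
    unfold SeqTest.StreamModel.gapStar
    exact ⟨by rw [h1, measure_univ], by rw [h2, measure_univ]⟩
  · rintro ι l α β J m M A hα hβ hα0 - hm hJ ⟨δ, hδ, hI⟩ ⟨v, hv⟩ hA ⟨b, hb⟩
    exact ⟨fun k => (M k).gapStar_mem_control (hm k).1 (hm k).2 (hα k) (hβ k),
      fun h => SeqTest.tendsto_varying hα hβ hα0 hm hJ hδ hI hv hA hb h⟩
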